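/- **Proposition (Local lower bound).** *Mesh.* Let $d\in\{1,2,3\}$, $\Omega=(0,1)^d$ with opposite sides identified (periodic boundary conditions), and let $\mathcal K$ be a finite partition of $\Omega$ (up to a null set) into disjoint open connected elements $\kappa$ with boundaries of finite $(d-1)$-dimensional surface measure, regular also across the periodic boundary: up to a set of zero surface measure, $\partial\kappa$ consists of flat pieces, each shared, modulo $\mathbb Z^d$, with exactly one other element $\kappa'\ne\kappa$. Let $n_\kappa$ be the exterior unit normal. On $\partial\kappa$ the jumps are $[\![v]\!]=v|_\kappa n_\kappa+v|_{\kappa'}n_{\kappa'}$ and $[\![\nabla v]\!]=\nabla v|_\kappa\cdot n_\kappa+\nabla v|_{\kappa'}\cdot n_{\kappa'}$. The patch $\omega(\kappa)$ consists of $\kappa$ and the elements sharing a face with it. For a set $S$, $\|\cdot\|_S$ is the norm and $(\cdot,\cdot)_S$ the scalar product of $L^2(S)$. *Spaces.* For each $\kappa$ let $\mathbb V_N(\kappa)\subset H^1(\kappa)$ be a finite-dimensional space containing the constants, whose elements $v$ have $\Delta v\in L^2(\kappa)$ and traces $v|_{\partial\kappa},\ \nabla v\cdot n_\kappa\in L^2(\partial\kappa)$;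 let $\mathbb V_N=\bigoplus_\kappa\mathbb V_N(\kappa)$. Let $\langle v,w\rangle_\kappa=(\Pi_0v,\Pi_0w)_\kappa+(\nabla v,\nabla w)_\kappa$, with $\Pi_0v$ the mean value of $v$ on $\kappa$, let $|v|_{*,\kappa}=\langle v,v\rangle_\kappa^{1/2}$, and let $\perp$ denote orthogonality for $\langle\cdot,\cdot\rangle_\kappa$. *Problem.* Let $V$ be a smooth, bounded, positive potential on $\Omega$, let $\theta\in\mathbb R$, and $\gamma_\kappa>0$ for all $\kappa$. Let $u\in H^1_\#(\Omega)$ (periodic $H^1$ functions), with $u|_\kappa\in H^2(\kappa)$ for all $\kappa$ and $\|u\|_\Omega=1$, be a weak solution of $-\Delta u+Vu=\lambda u$ with periodic boundary conditions. Let $u_N\in\mathbb V_N$ with $\|u_N\|_\Omega=1$ satisfy $a(u_N,v_N)=\lambda_N(u_N,v_N)_\Omega$ for all $v_N\in\mathbb V_N$, where $$a(w,v)=\sum_{\kappa}\big[(\nabla w,\nabla v)_\kappa+(Vw,v)_\kappa\big]+\tfrac12\sum_{\kappa}\big[-(\nabla w,[\![v]\!])_{\partial\kappa}-\theta([\![w]\!],\nabla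 v)_{\partial\kappa}+\gamma_\kappa([\![w]\!],[\![v]\!])_{\partial\kappa}\big].$$ (The case of interest is that of the smallest, non-degenerate eigenvalues; this is not needed.) *Constants and estimators.* Put $$\mathtt a_\kappa=\sup_{v\in H^1(\kappa),\,v\perp\mathbb V_N(\kappa)}\frac{\|v\|_\kappa}{|v|_{*,\kappa}},\quad \mathtt b_\kappa=\sup_{v\in H^1(\kappa),\,v\perp\mathbb V_N(\kappa)}\frac{\|v\|_{\partial\kappa}}{|v|_{*,\kappa}},\quad \mathtt d_\kappa=\sup_{v\in\mathbb V_N(\kappa)}\frac{\|\nabla v\cdot n_\kappa\|_{\partial\kappa}}{|v|_{*,\kappa}},$$ $$\mathtt d^u_\kappa=\frac{\|\nabla(u-u_N)\cdot n_\kappa\|_{\partial\kappa}}{\|\nabla(u-u_N)\|_\kappa},\qquad \mathtt c_\kappa=\mathtt d^u_\kappa+\mathtt d_\kappa|\theta|,\qquad \widehat\gamma_\kappa=\max_{\kappa'\in\omega(\kappa)\setminus\{\kappa\}}\tfrac12(\gamma_\kappa+\gamma_{\kappa'}),$$ $$R=\lambda_Nu_N+\Delta u_N-Vu_N\ \text{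 on each element},$$ $$\eta_{R,\kappa}=\mathtt a_\kappa\|R\|_\kappa,\qquad \eta_{F,\kappa}=\tfrac{\mathtt b_\kappa}{2}\|[\![\nabla u_N]\!]\|_{\partial\kappa},\qquad \eta_{J,\kappa}=\big(\mathtt b_\kappa\widehat\gamma_\kappa+\tfrac{\mathtt c_\kappa}{2}\big)\|[\![u_N]\!]\|_{\partial\kappa}.$$ Fix $\kappa\in\mathcal K$. Let $g_\kappa\ge 0$ be a bubble function on $\kappa$: continuous, smooth in $\kappa$, zero outside $\kappa$, with $\sup_\kappa g_\kappa=1$. Assume $g_\kappa R\in H^1_0(\kappa)$, and $\|g_\kappa^{1/2}R\|_\kappa\ne0$ unless $R=0$ a.e. on $\kappa$. Let $\varphi_\kappa\in H^1_0(\kappa)$ be the weak solution of $$\Delta\varphi_\kappa=Vg_\kappa R\quad\text{on }\kappa .$$ Put $$c_{R,\kappa}=\mathtt a_\kappa\frac{\|R\|_\kappa\,\|\nabla(g_\kappa R-\varphi_\kappa)\|_\kappa}{\|g_\kappa^{1/2}R\|_\kappa^2},\quad c_{F,\kappa}=\mathtt b_\kappa\sqrt{\tfrac{|\omega(\kappa)|}{2}}\max_{\kappa'\in\omega(\kappa)}\mathtt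 d^u_{\kappa'},\quad c_{J,\kappa}=\sqrt{\tfrac2{\gamma_\kappa}}\big(\mathtt b_\kappa\widehat\gamma_\kappa+\tfrac{\mathtt c_\kappa}2\big),$$ $$\mathrm{hot}^{\mathrm{lb}}_\kappa=\|\lambda_Nu_N-\lambda u\|_\kappa\frac{\|g_\kappa R\|_\kappa}{\|\nabla(g_\kappa R-\varphi_\kappa)\|_\kappa},$$ $$|||v|||_\kappa^2=\|\nabla v\|_\kappa^2+\tfrac{\gamma_\kappa}2\|[\![v]\!]\|_{\partial\kappa}^2+\|V^{1/2}v\|_\kappa^2,\qquad |||v|||_{\omega(\kappa)}^2=\frac1{|\omega(\kappa)|}\sum_{\kappa'\in\omega(\kappa)}\|\nabla v\|_{\kappa'}^2+\tfrac{\gamma_\kappa}2\|[\![v]\!]\|_{\partial\kappa}^2,$$ with $0/0=0$ throughout. *Claim.* $$\xi_\kappa:=\max\Big\{\frac{\eta_{R,\kappa}}{c_{R,\kappa}},\frac{\eta_{F,\kappa}}{c_{F,\kappa}},\frac{\eta_{J,\kappa}}{c_{J,\kappa}}\Big\}\ \le\ \max\Big\{|||u-u_N|||_\kappa+\mathrm{hot}^{\mathrm{lb}}_\kappa,\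 |||u-u_N|||_{\omega(\kappa)}\Big\}.$$ -/

import Mathlib

open MeasureTheory Set Filter Topology
open scoped ContDiff ENNReal MeasureTheory

noncomputable section

namespace DGEigen

/-! ### The periodic unit cube -/

/-- `ℝ^d` with its Euclidean norm. -/
abbrev Space (d : ℕ) := EuclideanSpace ℝ (Fin d)

/-- The computational domain `Ω = (0,1)^d`. -/
def cube (d : ℕ) : Set (Space d) := {x | ∀ i, 0 < x i ∧ x i < 1}

/-- The period lattice `ℤ^d`. -/
def lattice (d : ℕ) : Set (Space d) := {z | ∀ i, ∃ m : ℤ, z i = (m : ℝ)}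

def IsPeriodic {d : ℕ} {X : Type*} (f : Space d → X) : Prop :=
  ∀ x, ∀ z ∈ lattice d, f (x + z) = f x

/-! ### Sobolev functions on an open set `U`

All operators below (`wgrad`, `wlap`, `trace`, `normalDeriv`) only depend on the restriction of
the function to `U`, up to null sets, and are determined up to null sets. -/

/-- `χ ∈ C_c^∞(U)`. -/
def IsTest {d : ℕ} (U : Set (Space d)) (χ : Space d → ℝ) : Prop :=
  ContDiff ℝ ∞ χ ∧ HasCompactSupport χ ∧ tsupport χ ⊆ U

/-- `v, G ∈ L²(U)` and `G` is the distributional gradient of `v` on `U`. -/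
def IsWeakGrad {d : ℕ} (U : Set (Space d)) (v : Space d → ℝ) (G : Space d → Space d) : Prop :=
  MemLp v 2 (volume.restrict U) ∧ MemLp G 2 (volume.restrict U) ∧
    ∀ χ, IsTest U χ → ∫ x in U, v x • gradient χ x = -∫ x in U, χ x • G x

/-- `v ∈ H¹(U)`. -/
def MemH1 {d : ℕ} (U : Set (Space d)) (v : Space d → ℝ) : Prop := ∃ G, IsWeakGrad U v G

open Classical in
/-- The weak gradient `∇v` of `v ∈ H¹(U)`. -/
def wgrad {d : ℕ} (U : Set (Space d)) (v : Space d → ℝ) : Space d → Space d :=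
  if h : MemH1 U v then h.choose else 0

/-- `v ∈ H²(U)`. -/
def MemH2 {d : ℕ} (U : Set (Space d)) (v : Space d → ℝ) : Prop :=
  MemH1 U v ∧ ∀ i, MemH1 U (fun x => wgrad U v x i)

/-- `v ∈ H¹_0(U)`, the closure of `C_c^∞(U)` in `H¹(U)`. -/
def MemH10 {d : ℕ} (U : Set (Space d)) (v : Space d → ℝ) : Prop :=
  MemH1 U v ∧ ∃ χ : ℕ → Space d → ℝ, (∀ n, IsTest U (χ n)) ∧
    Tendsto (fun n => eLpNorm (v - χ n) 2 (volume.restrict U)) atTop (𝓝 0) ∧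
    Tendsto (fun n => eLpNorm (wgrad U v - gradient (χ n)) 2 (volume.restrict U)) atTop (𝓝 0)

/-- `v ∈ H¹(U)` has distributional Laplacian `f ∈ L²(U)`. -/
def IsWeakLap {d : ℕ} (U : Set (Space d)) (v f : Space d → ℝ) : Prop :=
  MemH1 U v ∧ MemLp f 2 (volume.restrict U) ∧
    ∀ χ, IsTest U χ → ∫ x in U, inner ℝ (wgrad U v x) (gradient χ x) = -∫ x in U, f x * χ x

open Classical in
/-- The Laplacian `Δv`, when it exists as an `L²(U)` function. -/
def wlap {d : ℕ} (U : Set (Space d)) (v : Space d → ℝ) : Space d → ℝ :=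
  if h : ∃ f, IsWeakLap U v f then h.choose else 0

/-! ### Boundary: surface measure, exterior normal, traces -/

/-- The `(d-1)`-dimensional surface measure on `∂U`. -/
def bdry {d : ℕ} (U : Set (Space d)) : Measure (Space d) := μHE[d - 1].restrict (frontier U)

/-- Near the boundary point `x`, the set `U` is an open half-space with exterior unit normal `n`. -/
def HasNormal {d : ℕ} (U : Set (Space d)) (x n : Space d) : Prop :=
  x ∈ frontier U ∧ ‖n‖ = 1 ∧ ∃ r > 0, ∀ y ∈ Metric.ball x r, (y ∈ U ↔ inner ℝ n (y - x) < 0)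

open Classical in
/-- The exterior unit normal `n_U` on the flat part of `∂U`. -/
def normal {d : ℕ} (U : Set (Space d)) (x : Space d) : Space d :=
  if h : ∃ n, HasNormal U x n then h.choose else 0

/-- `τ ∈ L²(∂U)` is the trace of `v ∈ H¹(U)`, characterised by Green's formula
`∫_U (v ∇χ + χ ∇v) = ∫_{∂U} τ χ n`. -/
def IsTrace {d : ℕ} (U : Set (Space d)) (v τ : Space d → ℝ) : Prop :=
  MemH1 U v ∧ MemLp τ 2 (bdry U) ∧ ∀ χ : Space d → ℝ, ContDiff ℝ ∞ χ →
    ∫ x in U, (v x • gradient χ x + χ x • wgrad U v x) = ∫ x, (τ x * χ x) • normal U x ∂(bdry U)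

def HasTrace {d : ℕ} (U : Set (Space d)) (v : Space d → ℝ) : Prop := ∃ τ, IsTrace U v τ

open Classical in
/-- The trace `v|_{∂U}`. -/
def trace {d : ℕ} (U : Set (Space d)) (v : Space d → ℝ) : Space d → ℝ :=
  if h : HasTrace U v then h.choose else 0

/-- `ν ∈ L²(∂U)` is the normal trace `∇v · n` of the gradient of a function `v ∈ H¹(U)` with
`Δv ∈ L²(U)`, characterised by Green's formula `∫_U (∇v·∇χ + Δv χ) = ∫_{∂U} ν χ`. For
`v ∈ H²(U)` it is the scalar product of the trace of `∇v` with `n`. -/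
def IsNormalDeriv {d : ℕ} (U : Set (Space d)) (v ν : Space d → ℝ) : Prop :=
  (∃ f, IsWeakLap U v f) ∧ MemLp ν 2 (bdry U) ∧ ∀ χ : Space d → ℝ, ContDiff ℝ ∞ χ →
    ∫ x in U, (inner ℝ (wgrad U v x) (gradient χ x) + wlap U v x * χ x)
      = ∫ x, ν x * χ x ∂(bdry U)

def HasNormalDeriv {d : ℕ} (U : Set (Space d)) (v : Space d → ℝ) : Prop :=
  ∃ ν, IsNormalDeriv U v ν

open Classical in
/-- The normal derivative `∇v · n` on `∂U`. -/
def normalDeriv {d : ℕ} (U : Set (Space d)) (v : Space d → ℝ) : Space d → ℝ :=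
  if h : HasNormalDeriv U v then h.choose else 0

/-! ### Norms on a single element, with values in `[0,∞]`

A norm is `∞` on a function that does not lie in the corresponding space. -/

/-- `‖v‖_U`. -/
def l2Norm {d : ℕ} (U : Set (Space d)) (v : Space d → ℝ) : ℝ≥0∞ :=
  eLpNorm v 2 (volume.restrict U)

open Classical in
/-- `‖∇v‖_U`. -/
def gradNorm {d : ℕ} (U : Set (Space d)) (v : Space d → ℝ) : ℝ≥0∞ :=
  if MemH1 U v then eLpNorm (wgrad U v) 2 (volume.restrict U) else ⊤

open Classical in
/-- `‖v‖_{∂U}`. -/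
def traceNorm {d : ℕ} (U : Set (Space d)) (v : Space d → ℝ) : ℝ≥0∞ :=
  if HasTrace U v then eLpNorm (trace U v) 2 (bdry U) else ⊤

open Classical in
/-- `‖∇v · n‖_{∂U}`. -/
def normalDerivNorm {d : ℕ} (U : Set (Space d)) (v : Space d → ℝ) : ℝ≥0∞ :=
  if HasNormalDeriv U v then eLpNorm (normalDeriv U v) 2 (bdry U) else ⊤

/-- The scalar product `(Π₀v, Π₀w)_U + (∇v, ∇w)_U` on `H¹(U)`, where `Π₀` is the mean value. -/
def sscal {d : ℕ} (U : Set (Space d)) (v w : Space d → ℝ) : ℝ :=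
  (∫ _ in U, (⨍ y in U, v y) * (⨍ y in U, w y)) + ∫ x in U, inner ℝ (wgrad U v x) (wgrad U w x)

/-- The norm of the scalar product `sscal`. -/
def snorm {d : ℕ} (U : Set (Space d)) (v : Space d → ℝ) : ℝ≥0∞ :=
  ENNReal.ofReal (Real.sqrt (sscal U v v))

/-! ### Meshes -/

/-- For a family of sets `elem` and `x ∈ ∂(elem k)`: the pairs `(k', x')` such that `x'` is the same
point as `x` modulo the periods, and `elem k'` lies, near `x'`, exactly on the other side of the
flat piece of boundary of `elem k` through `x`. -/
def acrossSet {d : ℕ} {ι : Type*} (elem : ι → Set (Space d)) (k : ι) (x : Space d) :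
    Set (ι × Space d) :=
  {p | p.2 - x ∈ lattice d ∧ ∃ n, HasNormal (elem k) x n ∧ HasNormal (elem p.1) p.2 (-n)}

/-- A finite partition of `Ω = (0,1)^d` into open connected elements, regular across the periodic
boundary: up to a set of zero surface measure, the boundary of each element consists of flat
pieces which the element shares with another element. -/
structure PeriodicMesh (d : ℕ) (ι : Type*) [Fintype ι] where
  elem : ι → Set (Space d)
  isOpen : ∀ k, IsOpen (elem k)
  isConnected : ∀ k, IsConnected (elem k)
  subset_cube : ∀ k, elem k ⊆ cube d
  disjoint : Pairwise fun k k' => Disjoint (elem k) (elem k')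
  cover : volume (cube d \ ⋃ k, elem k) = 0
  bdry_finite : ∀ k, μHE[d - 1] (frontier (elem k)) < ⊤
  exists_across : ∀ k, ∀ᵐ x ∂(bdry (elem k)), (acrossSet elem k x).Nonempty
  across_ne : ∀ k x, ∀ p ∈ acrossSet elem k x, p.1 ≠ k

section Mesh

variable {d : ℕ} {ι : Type*} [Fintype ι]

/-- The element and the boundary point across the face of `k` at `x` (unique when it exists). -/
def PeriodicMesh.across (T : PeriodicMesh d ι) (k : ι) (x : Space d) : Set (ι × Space d) :=
  acrossSet T.elem k x

open Classical in
/-- The elements sharing a face with `k`. -/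
def PeriodicMesh.neighbors (T : PeriodicMesh d ι) (k : ι) : Finset ι :=
  Finset.univ.filter fun k' => ∃ x, ∃ p ∈ T.across k x, p.1 = k'

open Classical in
/-- The patch `ω(k)`: `k` and the elements sharing a face with it. -/
def PeriodicMesh.patch (T : PeriodicMesh d ι) (k : ι) : Finset ι := insert k (T.neighbors k)

/-- The jump `⟦v⟧ = v|_k n_k + v|_{k'} n_{k'}` at the point `x ∈ ∂k`. -/
def jump (T : PeriodicMesh d ι) (v : Space d → ℝ) (k : ι) (x : Space d) : Space d :=
  trace (T.elem k) v x • normal (T.elem k) x +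
    ∑ᶠ p ∈ T.across k x, trace (T.elem p.1) v p.2 • normal (T.elem p.1) p.2

/-- The jump `⟦∇v⟧ = ∇v|_k · n_k + ∇v|_{k'} · n_{k'}` at the point `x ∈ ∂k`. -/
def gradJump (T : PeriodicMesh d ι) (v : Space d → ℝ) (k : ι) (x : Space d) : ℝ :=
  normalDeriv (T.elem k) v x + ∑ᶠ p ∈ T.across k x, normalDeriv (T.elem p.1) v p.2

open Classical in
/-- `‖⟦v⟧‖_{∂k}`. -/
def jumpNorm (T : PeriodicMesh d ι) (v : Space d → ℝ) (k : ι) : ℝ≥0∞ :=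
  if ∀ k' ∈ T.patch k, HasTrace (T.elem k') v then eLpNorm (jump T v k) 2 (bdry (T.elem k)) else ⊤

open Classical in
/-- `‖⟦∇v⟧‖_{∂k}`. -/
def gradJumpNorm (T : PeriodicMesh d ι) (v : Space d → ℝ) (k : ι) : ℝ≥0∞ :=
  if ∀ k' ∈ T.patch k, HasNormalDeriv (T.elem k') v then
    eLpNorm (gradJump T v k) 2 (bdry (T.elem k)) else ⊤

/-- The local energy norm `|||v|||_k`. -/
def energy (T : PeriodicMesh d ι) (V : Space d → ℝ) (γ : ι → ℝ) (v : Space d → ℝ) (k : ι) : ℝ≥0∞ :=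
  (gradNorm (T.elem k) v ^ 2 + ENNReal.ofReal (γ k / 2) * jumpNorm T v k ^ 2 +
    l2Norm (T.elem k) (fun x => Real.sqrt (V x) * v x) ^ 2) ^ (1 / 2 : ℝ)

/-- The patch norm `|||v|||_{ω(k)}`. -/
def patchEnergy (T : PeriodicMesh d ι) (γ : ι → ℝ) (v : Space d → ℝ) (k : ι) : ℝ≥0∞ :=
  ((∑ k' ∈ T.patch k, gradNorm (T.elem k') v ^ 2) / ((T.patch k).card : ℝ≥0∞) +
    ENNReal.ofReal (γ k / 2) * jumpNorm T v k ^ 2) ^ (1 / 2 : ℝ)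

/-! ### Approximation space, eigenvalue problem and its discretisation -/

/-- A piecewise approximation space: for each element, a finite-dimensional space of functions in
`L²(k)` that contains the constants and whose members are `H¹` with square-integrable Laplacian
and with traces of the function and of its normal derivative in `L²(∂k)`. -/
structure DGSpace (T : PeriodicMesh d ι) where
  space : ∀ k, Submodule ℝ (Lp ℝ 2 (volume.restrict (T.elem k)))
  finiteDimensional : ∀ k, FiniteDimensional ℝ (space k)
  const_mem : ∀ k, ∃ w ∈ space k, w =ᵐ[volume.restrict (T.elem k)] fun _ => (1 : ℝ)
  regular : ∀ k, ∀ w ∈ space k, HasTrace (T.elem k) w ∧ HasNormalDeriv (T.elem k) w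

/-- `v ∈ 𝕍_N`. -/
def DGSpace.Mem {T : PeriodicMesh d ι} (W : DGSpace T) (v : Space d → ℝ) : Prop :=
  ∀ k, ∃ w ∈ W.space k, v =ᵐ[volume.restrict (T.elem k)] w

/-- The interior penalty bilinear form `a(w,v)`. On `∂k` the jump is parallel to `n_k`, so that
`∇w · ⟦v⟧ = (∇w · n_k) (n_k · ⟦v⟧)`. -/
def dgForm (T : PeriodicMesh d ι) (V : Space d → ℝ) (θ : ℝ) (γ : ι → ℝ) (w v : Space d → ℝ) : ℝ :=
  (∑ k, ((∫ x in T.elem k, inner ℝ (wgrad (T.elem k) w x) (wgrad (T.elem k) v x)) +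
      ∫ x in T.elem k, V x * w x * v x)) +
  (1 / 2) * ∑ k,
    (-(∫ x, normalDeriv (T.elem k) w x * inner ℝ (normal (T.elem k) x) (jump T v k x)
          ∂(bdry (T.elem k)))
      - θ * (∫ x, normalDeriv (T.elem k) v x * inner ℝ (normal (T.elem k) x) (jump T w k x)
          ∂(bdry (T.elem k)))
      + γ k * ∫ x, inner ℝ (jump T w k x) (jump T v k x) ∂(bdry (T.elem k)))

/-- `V` is (the periodic extension of) a bounded, smooth, positive potential on `Ω`. -/
structure IsPotential (V : Space d → ℝ) : Prop where
  periodic : IsPeriodic V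
  smooth : ContDiffOn ℝ ∞ V (cube d)
  bounded : ∃ C, ∀ x ∈ cube d, V x ≤ C
  pos : ∀ x ∈ cube d, 0 < V x

/-- `G` is the weak gradient of the periodic function `u ∈ H¹_#(Ω)`; functions on `Ω` are identified
with their periodic extensions. -/
structure IsPeriodicGrad (u : Space d → ℝ) (G : Space d → Space d) : Prop where
  periodic : IsPeriodic u
  periodic_grad : IsPeriodic G
  memLp : MemLp u 2 (volume.restrict (cube d))
  memLp_grad : MemLp G 2 (volume.restrict (cube d))
  weak : ∀ χ, IsTest univ χ → ∫ x, u x • gradient χ x = -∫ x, χ x • G x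

/-- `u ∈ H¹_#(Ω)`, `‖u‖_Ω = 1` and `-Δu + V u = lam u` with periodic boundary conditions. -/
def IsEigenpair (V : Space d → ℝ) (lam : ℝ) (u : Space d → ℝ) : Prop :=
  ∫ x in cube d, u x ^ 2 = 1 ∧ ∃ G, IsPeriodicGrad u G ∧ ∀ χ, IsTest univ χ →
    (∫ x, inner ℝ (G x) (gradient χ x)) + ∫ x, V x * u x * χ x = lam * ∫ x, u x * χ x

/-- `u_N ∈ 𝕍_N`, `‖u_N‖_Ω = 1` and `a(u_N, v_N) = lamN (u_N, v_N)_Ω` for all `v_N ∈ 𝕍_N`. -/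
def IsDGEigenpair {T : PeriodicMesh d ι} (W : DGSpace T) (V : Space d → ℝ) (θ : ℝ) (γ : ι → ℝ)
    (lamN : ℝ) (uN : Space d → ℝ) : Prop :=
  W.Mem uN ∧ ∫ x in cube d, uN x ^ 2 = 1 ∧
    ∀ v, W.Mem v → dgForm T V θ γ uN v = lamN * ∫ x in cube d, uN x * v x

/-! ### Local constants and estimators -/

/-- `d_k = sup ‖∇v_N·n‖_{∂k} / snorm v_N` over `v_N ∈ 𝕍_N(k)`. -/
def constD {T : PeriodicMesh d ι} (W : DGSpace T) (k : ι) : ℝ≥0∞ :=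
  ⨆ w ∈ W.space k, normalDerivNorm (T.elem k) w / snorm (T.elem k) w

/-- `v ∈ H¹(k)` and `v ⊥ 𝕍_N(k)` for the scalar product `sscal`. -/
def PerpSpace {T : PeriodicMesh d ι} (W : DGSpace T) (k : ι) (v : Space d → ℝ) : Prop :=
  MemH1 (T.elem k) v ∧ ∀ w ∈ W.space k, sscal (T.elem k) v w = 0

/-- `a_k`. -/
def constA {T : PeriodicMesh d ι} (W : DGSpace T) (k : ι) : ℝ≥0∞ :=
  ⨆ (v : Space d → ℝ) (_ : PerpSpace W k v), l2Norm (T.elem k) v / snorm (T.elem k) v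

/-- `b_k`. -/
def constB {T : PeriodicMesh d ι} (W : DGSpace T) (k : ι) : ℝ≥0∞ :=
  ⨆ (v : Space d → ℝ) (_ : PerpSpace W k v), traceNorm (T.elem k) v / snorm (T.elem k) v

/-- `d^u_k(u_N)`, as a function of the error `e = u - u_N`. -/
def constDu (T : PeriodicMesh d ι) (e : Space d → ℝ) (k : ι) : ℝ≥0∞ :=
  normalDerivNorm (T.elem k) e / gradNorm (T.elem k) e

/-- `c_k = d^u_k + d_k |θ|`. -/
def constC {T : PeriodicMesh d ι} (W : DGSpace T) (θ : ℝ) (e : Space d → ℝ) (k : ι) : ℝ≥0∞ :=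
  constDu T e k + constD W k * ENNReal.ofReal |θ|

/-- `γ̂_k`, the maximum over `∂k` of the average of `γ`, which is constant on each face. -/
def gammaHat (T : PeriodicMesh d ι) (γ : ι → ℝ) (k : ι) : ℝ≥0∞ :=
  ⨆ k' ∈ T.neighbors k, ENNReal.ofReal ((γ k + γ k') / 2)

/-- The residual `R = lamN u_N + Δu_N - V u_N` on the element `k`. -/
def residual (T : PeriodicMesh d ι) (V : Space d → ℝ) (lamN : ℝ) (uN : Space d → ℝ) (k : ι) :
    Space d → ℝ :=
  fun x => lamN * uN x + wlap (T.elem k) uN x - V x * uN x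

/-- `η_{R,k}`. -/
def etaR {T : PeriodicMesh d ι} (W : DGSpace T) (V : Space d → ℝ) (lamN : ℝ) (uN : Space d → ℝ)
    (k : ι) : ℝ≥0∞ :=
  constA W k * l2Norm (T.elem k) (residual T V lamN uN k)

/-- `η_{F,k}`. -/
def etaF {T : PeriodicMesh d ι} (W : DGSpace T) (uN : Space d → ℝ) (k : ι) : ℝ≥0∞ :=
  constB W k / 2 * gradJumpNorm T uN k

/-- `η_{J,k}`. -/
def etaJ {T : PeriodicMesh d ι} (W : DGSpace T) (θ : ℝ) (γ : ι → ℝ) (u uN : Space d → ℝ)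
    (k : ι) : ℝ≥0∞ :=
  (constB W k * gammaHat T γ k + constC W θ (u - uN) k / 2) * jumpNorm T uN k

/-- A bubble function on the element `U`. -/
structure IsBubble (U : Set (Space d)) (g : Space d → ℝ) : Prop where
  continuous : Continuous g
  smooth : ContDiffOn ℝ ∞ g U
  nonneg : ∀ x, 0 ≤ g x
  support_subset : Function.support g ⊆ U
  isLUB : IsLUB (g '' U) 1

/-- `φ ∈ H¹_0(U)` is the weak solution of `Δφ = f` on `U`. -/
def IsDirichletSolution (U : Set (Space d)) (f φ : Space d → ℝ) : Prop :=
  MemH10 U φ ∧ ∀ χ, IsTest U χ →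
    ∫ x in U, inner ℝ (wgrad U φ x) (gradient χ x) = -∫ x in U, f x * χ x

/-- `c_{R,k}`, with bubble function `g`, residual `R` and local solution `φ`. -/
def constCR {T : PeriodicMesh d ι} (W : DGSpace T) (g R φ : Space d → ℝ) (k : ι) : ℝ≥0∞ :=
  constA W k *
    (l2Norm (T.elem k) R * gradNorm (T.elem k) (fun x => g x * R x - φ x) /
      l2Norm (T.elem k) (fun x => Real.sqrt (g x) * R x) ^ 2)

/-- `c_{F,k}`. -/
def constCF {T : PeriodicMesh d ι} (W : DGSpace T) (u uN : Space d → ℝ) (k : ι) : ℝ≥0∞ :=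
  constB W k * ENNReal.ofReal (Real.sqrt ((T.patch k).card / 2)) *
    ⨆ k' ∈ T.patch k, constDu T (u - uN) k'

/-- `c_{J,k}`. -/
def constCJ {T : PeriodicMesh d ι} (W : DGSpace T) (θ : ℝ) (γ : ι → ℝ) (u uN : Space d → ℝ)
    (k : ι) : ℝ≥0∞ :=
  ENNReal.ofReal (Real.sqrt (2 / γ k)) *
    (constB W k * gammaHat T γ k + constC W θ (u - uN) k / 2)

/-- `hot^lb_k`, with bubble function `g`, residual `R` and local solution `φ`. -/
def hotLB (T : PeriodicMesh d ι) (lam lamN : ℝ) (u uN g R φ : Space d → ℝ) (k : ι) : ℝ≥0∞ :=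
  l2Norm (T.elem k) (fun x => lamN * uN x - lam * u x) *
    (l2Norm (T.elem k) (fun x => g x * R x) /
      gradNorm (T.elem k) (fun x => g x * R x - φ x))

/-- `ξ_k`. -/
def xi {T : PeriodicMesh d ι} (W : DGSpace T) (V : Space d → ℝ) (θ : ℝ) (γ : ι → ℝ)
    (lamN : ℝ) (u uN g φ : Space d → ℝ) (k : ι) : ℝ≥0∞ :=
  max (etaR W V lamN uN k / constCR W g (residual T V lamN uN k) φ k)
    (max (etaF W uN k / constCF W u uN k) (etaJ W θ γ u uN k / constCJ W θ γ u uN k))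

end Mesh

end DGEigen

end

namespace DGEigen

/-! ### Weak gradients, weak Laplacians and traces: uniqueness and linearity. -/

section Basics

variable {d : ℕ} {U : Set (Space d)}

/-! ### Test functions -/

/-! Write `e = u - uN`. Each of the three ratios is bounded separately; the constants `a`, `b`, `c`
cancel from numerator and denominator, up to degenerate values in `[0,∞]` (a quotient with
denominator `∞` is `0`), which are split off as cases.

Jump term. The exact solution does not jump, so the jump of `uN` is minus the jump of `e`, and the
ratio is at most `sqrt(γ/2)` times the norm of the jump of `e`, which is one term of the energy norm
(`etaJ_div_constCJ_le`).

Face term. The flux of `u` is continuous too, so the gradient jump of `uN` is minus that of `e`. Its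
square is at most twice the sum of `‖∇e · n‖²` over the patch (`gradJumpNorm_sq_le`), and the
maximum of `d^u` turns normal derivatives into gradients (`etaF_div_constCF_le`).

Residual term. With `w = gR` one has `∫ R w = ‖g^{1/2} R‖²`. Inserting the equation for `u` and
integrating by parts in `H¹_0`, `∫ R w = (lamN uN - lam u, w) + (∇e, ∇w) + (V e, w)`. Since `Δφ = V
w`, `‖∇(w - φ)‖² = ‖∇w‖² + 2‖V^{1/2} w‖² + ‖∇φ‖²`, so Cauchy-Schwarz bounds the last two terms by
`sqrt(‖∇e‖² + ‖V^{1/2} e‖²) ‖∇(w - φ)‖` (`residual_bound`, `etaR_div_constCR_le`).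

Most of the work lies in the continuity of `u` across faces. Traces are characterised by Green's
formula only, and `trace (u - uN) + trace uN` stands in for the trace of `u`. Near a face point the
two neighbouring elements are, modulo periods, complementary half-balls; adding Green's formula on
both sides reproduces the global weak identity for `u`, so the boundary terms must cancel
(`IsFace.trace_add_ae_eq`, `IsFace.normalDeriv_add_ae_eq`). If the error has no trace, its norm is
`∞` and nothing is to be shown. -/

lemma IsTest.continuous {χ : Space d → ℝ} (h : IsTest U χ) : Continuous χ := h.1.continuous

lemma continuous_gradient {χ : Space d → ℝ} (h : ContDiff ℝ ∞ χ) : Continuous (gradient χ) :=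
  (InnerProductSpace.toDual ℝ (Space d)).symm.continuous.comp
    (h.continuous_fderiv (by simp))

lemma gradient_eq_zero_of_notMem_tsupport {χ : Space d → ℝ} {x : Space d} (hx : x ∉ tsupport χ) :
    gradient χ x = 0 := by
  have : fderiv ℝ χ x = 0 := by
    by_contra h
    exact hx (support_fderiv_subset ℝ h)
  simp [gradient, this]

lemma hasCompactSupport_gradient {χ : Space d → ℝ} (h : HasCompactSupport χ) :
    HasCompactSupport (gradient χ) :=
  HasCompactSupport.intro h fun _ hx => gradient_eq_zero_of_notMem_tsupport hx

lemma gradient_comp_sub (χ : Space d → ℝ) (z y : Space d) :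
    gradient (fun y => χ (y - z)) y = gradient χ (y - z) := by
  simp only [gradient]
  rw [fderiv_comp_sub]

lemma IsTest.mono {U' : Set (Space d)} {χ : Space d → ℝ} (h : IsTest U χ) (hU : U ⊆ U') :
    IsTest U' χ := ⟨h.1, h.2.1, h.2.2.trans hU⟩

lemma IsTest.memLp {χ : Space d → ℝ} (h : IsTest U χ) (p : ℝ≥0∞) :
    MemLp χ p (volume.restrict U) :=
  (h.continuous.memLp_of_hasCompactSupport h.2.1).restrict U

lemma IsTest.memLp_gradient {χ : Space d → ℝ} (h : IsTest U χ) (p : ℝ≥0∞) :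
    MemLp (gradient χ) p (volume.restrict U) :=
  ((continuous_gradient h.1).memLp_of_hasCompactSupport
    (hasCompactSupport_gradient h.2.1)).restrict U

lemma IsTest.eq_zero {χ : Space d → ℝ} (h : IsTest U χ) {x : Space d} (hx : x ∉ U) : χ x = 0 :=
  image_eq_zero_of_notMem_tsupport fun h' => hx (h.2.2 h')

lemma IsTest.gradient_eq_zero {χ : Space d → ℝ} (h : IsTest U χ) {x : Space d} (hx : x ∉ U) :
    gradient χ x = 0 :=
  gradient_eq_zero_of_notMem_tsupport fun h' => hx (h.2.2 h')

lemma integrable_smul_of_memLp {E : Type*} [NormedAddCommGroup E] [NormedSpace ℝ E]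
    {α : Type*} [MeasurableSpace α] {μ : Measure α} {f : α → ℝ} {G : α → E}
    (hf : MemLp f 2 μ) (hG : MemLp G 2 μ) : Integrable (fun x => f x • G x) μ :=
  memLp_one_iff_integrable.1 (hG.smul hf)

lemma integrable_mul_of_memLp {α : Type*} [MeasurableSpace α] {μ : Measure α} {f g : α → ℝ}
    (hf : MemLp f 2 μ) (hg : MemLp g 2 μ) : Integrable (fun x => f x * g x) μ :=
  hf.integrable_mul hg

lemma integrable_inner_of_memLp {E : Type*} [NormedAddCommGroup E] [InnerProductSpace ℝ E]
    {α : Type*} [MeasurableSpace α] {μ : Measure α} {F G : α → E}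
    (hf : MemLp F 2 μ) (hG : MemLp G 2 μ) : Integrable (fun x => inner ℝ (F x) (G x)) μ := by
  refine (hf.norm.integrable_mul hG.norm).mono
    (hf.aestronglyMeasurable.inner hG.aestronglyMeasurable) (ae_of_all _ fun x => ?_)
  simpa using norm_inner_le_norm (𝕜 := ℝ) (F x) (G x)

/-- An `L²` function that is orthogonal to all test functions vanishes. -/
lemma ae_eq_zero_of_forall_isTest {E : Type*} [NormedAddCommGroup E] [NormedSpace ℝ E]
    [CompleteSpace E] (hU : IsOpen U) {f : Space d → E} (hf : MemLp f 2 (volume.restrict U))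
    (h : ∀ χ, IsTest U χ → ∫ x in U, χ x • f x = 0) : f =ᵐ[volume.restrict U] 0 := by
  have := hU.ae_eq_zero_of_integral_contDiff_smul_eq_zero (f := f) (μ := volume.restrict U)
    ((hf.locallyIntegrable (by norm_num)).locallyIntegrableOn U)
    fun χ h1 h2 h3 => h χ ⟨h1, h2, h3⟩
  filter_upwards [this, ae_restrict_mem hU.measurableSet] with x hx hxU using hx hxU

/-! ### Weak gradients and Laplacians -/

lemma IsWeakGrad.unique (hU : IsOpen U) {v : Space d → ℝ} {G G' : Space d → Space d}
    (h : IsWeakGrad U v G) (h' : IsWeakGrad U v G') : G =ᵐ[volume.restrict U] G' := by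
  have := ae_eq_zero_of_forall_isTest hU (h.2.1.sub h'.2.1) fun χ hχ => by
    simp only [Pi.sub_apply, smul_sub]
    rw [integral_sub (integrable_smul_of_memLp (hχ.memLp 2) h.2.1)
      (integrable_smul_of_memLp (hχ.memLp 2) h'.2.1), sub_eq_zero]
    exact neg_injective ((h.2.2 χ hχ).symm.trans (h'.2.2 χ hχ))
  filter_upwards [this] with x hx
  exact sub_eq_zero.1 hx

lemma MemH1.isWeakGrad {v : Space d → ℝ} (h : MemH1 U v) : IsWeakGrad U v (wgrad U v) := by
  rw [wgrad, dif_pos h]; exact h.choose_spec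

lemma IsWeakGrad.memH1 {v : Space d → ℝ} {G : Space d → Space d} (h : IsWeakGrad U v G) :
    MemH1 U v := ⟨G, h⟩

lemma IsWeakGrad.wgrad_ae (hU : IsOpen U) {v : Space d → ℝ} {G : Space d → Space d}
    (h : IsWeakGrad U v G) : wgrad U v =ᵐ[volume.restrict U] G :=
  h.memH1.isWeakGrad.unique hU h

lemma IsWeakGrad.sub {v w : Space d → ℝ} {G H : Space d → Space d}
    (h : IsWeakGrad U v G) (h' : IsWeakGrad U w H) : IsWeakGrad U (v - w) (G - H) := by
  refine ⟨h.1.sub h'.1, h.2.1.sub h'.2.1, fun χ hχ => ?_⟩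
  simp only [Pi.sub_apply, smul_sub, sub_smul]
  rw [integral_sub (integrable_smul_of_memLp h.1 (hχ.memLp_gradient 2))
      (integrable_smul_of_memLp h'.1 (hχ.memLp_gradient 2)),
    integral_sub (integrable_smul_of_memLp (hχ.memLp 2) h.2.1)
      (integrable_smul_of_memLp (hχ.memLp 2) h'.2.1), h.2.2 χ hχ, h'.2.2 χ hχ]
  abel

lemma IsWeakGrad.congr {v w : Space d → ℝ} {G : Space d → Space d}
    (h : IsWeakGrad U v G) (hvw : v =ᵐ[volume.restrict U] w) : IsWeakGrad U w G := by
  refine ⟨(memLp_congr_ae hvw).1 h.1, h.2.1, fun χ hχ => ?_⟩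
  rw [← h.2.2 χ hχ]
  exact integral_congr_ae (hvw.mono fun x hx => by simp only [hx])

lemma MemH1.congr {v w : Space d → ℝ} (h : MemH1 U v) (hvw : v =ᵐ[volume.restrict U] w) :
    MemH1 U w := (h.isWeakGrad.congr hvw).memH1

lemma MemH1.wgrad_congr (hU : IsOpen U) {v w : Space d → ℝ} (h : MemH1 U v)
    (hvw : v =ᵐ[volume.restrict U] w) : wgrad U w =ᵐ[volume.restrict U] wgrad U v :=
  (h.isWeakGrad.congr hvw).wgrad_ae hU

lemma MemH1.sub {v w : Space d → ℝ} (hv : MemH1 U v) (hw : MemH1 U w) : MemH1 U (v - w) :=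
  (hv.isWeakGrad.sub hw.isWeakGrad).memH1

lemma MemH1.wgrad_sub (hU : IsOpen U) {v w : Space d → ℝ} (hv : MemH1 U v) (hw : MemH1 U w) :
    wgrad U (v - w) =ᵐ[volume.restrict U] wgrad U v - wgrad U w :=
  (hv.isWeakGrad.sub hw.isWeakGrad).wgrad_ae hU

lemma IsWeakLap.unique (hU : IsOpen U) {v f f' : Space d → ℝ}
    (h : IsWeakLap U v f) (h' : IsWeakLap U v f') : f =ᵐ[volume.restrict U] f' := by
  have := ae_eq_zero_of_forall_isTest hU (h.2.1.sub h'.2.1) fun χ hχ => by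
    simp only [Pi.sub_apply, smul_sub]
    rw [integral_sub (integrable_smul_of_memLp (hχ.memLp 2) h.2.1)
      (integrable_smul_of_memLp (hχ.memLp 2) h'.2.1), sub_eq_zero]
    simp only [smul_eq_mul, mul_comm (χ _)]
    exact neg_injective ((h.2.2 χ hχ).symm.trans (h'.2.2 χ hχ))
  filter_upwards [this] with x hx
  exact sub_eq_zero.1 hx

lemma isWeakLap_wlap {v : Space d → ℝ} (h : ∃ f, IsWeakLap U v f) :
    IsWeakLap U v (wlap U v) := by
  rw [wlap, dif_pos h]; exact h.choose_spec

lemma IsWeakLap.wlap_ae (hU : IsOpen U) {v f : Space d → ℝ} (h : IsWeakLap U v f) :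
    wlap U v =ᵐ[volume.restrict U] f :=
  (isWeakLap_wlap ⟨f, h⟩).unique hU h

lemma IsWeakLap.sub (hU : IsOpen U) {v w f f' : Space d → ℝ}
    (h : IsWeakLap U v f) (h' : IsWeakLap U w f') : IsWeakLap U (v - w) (f - f') := by
  refine ⟨h.1.sub h'.1, h.2.1.sub h'.2.1, fun χ hχ => ?_⟩
  have e : ∫ x in U, inner ℝ (wgrad U (v - w) x) (gradient χ x) =
      ∫ x in U, (inner ℝ (wgrad U v x) (gradient χ x) - inner ℝ (wgrad U w x) (gradient χ x)) :=
    integral_congr_ae ((h.1.wgrad_sub hU h'.1).mono fun x hx => by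
      simp only [hx, Pi.sub_apply, inner_sub_left])
  simp only [e, Pi.sub_apply, sub_mul]
  rw [integral_sub (integrable_inner_of_memLp h.1.isWeakGrad.2.1 (hχ.memLp_gradient 2))
      (integrable_inner_of_memLp h'.1.isWeakGrad.2.1 (hχ.memLp_gradient 2)),
    integral_sub (integrable_mul_of_memLp h.2.1 (hχ.memLp 2))
      (integrable_mul_of_memLp h'.2.1 (hχ.memLp 2)),
    h.2.2 χ hχ, h'.2.2 χ hχ]
  ring

lemma IsWeakLap.congr (hU : IsOpen U) {v w f : Space d → ℝ} (h : IsWeakLap U v f)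
    (hvw : v =ᵐ[volume.restrict U] w) : IsWeakLap U w f := by
  refine ⟨h.1.congr hvw, h.2.1, fun χ hχ => ?_⟩
  rw [← h.2.2 χ hχ]
  exact integral_congr_ae ((h.1.wgrad_congr hU hvw).mono fun x hx => by simp only [hx])

/-! ### Traces -/

lemma HasTrace.isTrace {v : Space d → ℝ} (h : HasTrace U v) : IsTrace U v (trace U v) := by
  rw [trace, dif_pos h]; exact h.choose_spec

lemma HasNormalDeriv.isNormalDeriv {v : Space d → ℝ} (h : HasNormalDeriv U v) :
    IsNormalDeriv U v (normalDeriv U v) := by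
  rw [normalDeriv, dif_pos h]; exact h.choose_spec

lemma HasTrace.memH1 {v : Space d → ℝ} (h : HasTrace U v) : MemH1 U v := h.isTrace.1

/-- Members of the discrete space are fixed only up to null sets, so regularity has to be
transported along almost everywhere equality. -/
lemma HasTrace.congr (hU : IsOpen U) {v w : Space d → ℝ} (h : HasTrace U v)
    (hvw : v =ᵐ[volume.restrict U] w) : HasTrace U w := by
  obtain ⟨τ, h1, h2, h3⟩ := h
  refine ⟨τ, h1.congr hvw, h2, fun χ hχ => ?_⟩
  rw [← h3 χ hχ]
  refine integral_congr_ae ?_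
  filter_upwards [hvw, h1.wgrad_congr hU hvw] with x hx hx'
  simp only [hx, hx']

lemma HasNormalDeriv.congr (hU : IsOpen U) {v w : Space d → ℝ} (h : HasNormalDeriv U v)
    (hvw : v =ᵐ[volume.restrict U] w) : HasNormalDeriv U w := by
  obtain ⟨ν, ⟨f, h1⟩, h2, h3⟩ := h
  refine ⟨ν, ⟨f, h1.congr hU hvw⟩, h2, fun χ hχ => ?_⟩
  rw [← h3 χ hχ]
  refine integral_congr_ae ?_
  filter_upwards [h1.1.wgrad_congr hU hvw, h1.wlap_ae hU, (h1.congr hU hvw).wlap_ae hU]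
    with x hx hx' hx''
  simp only [hx, hx', hx'']

end Basics

/-! ### Half-space geometry near a flat boundary point. -/

section Geometry

variable {d : ℕ} {U U' : Set (Space d)} {x z n y : Space d} {r : ℝ}

/-! ### Flat pieces of boundary -/

lemma HasNormal.unique {n' : Space d} (h : HasNormal U x n) (h' : HasNormal U x n') : n = n' := by
  obtain ⟨-, hn, r, hr, H⟩ := h
  obtain ⟨-, hn', r', hr', H'⟩ := h'
  by_contra hne
  have hlt : inner ℝ n n' < 1 := lt_of_le_of_ne
    ((real_inner_le_norm n n').trans (by simp [hn, hn']))
    fun h => hne ((inner_eq_one_iff_of_norm_eq_one (𝕜 := ℝ) hn hn').1 h)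
  -- A small step in the direction `n' - n` enters `U` according to the normal `n` and leaves it
  -- according to `n'`.
  have ht : Tendsto (fun t : ℝ => x + t • (n' - n)) (𝓝[>] 0) (𝓝 x) := by
    have : Continuous fun t : ℝ => x + t • (n' - n) := by fun_prop
    simpa using (this.tendsto 0).mono_left nhdsWithin_le_nhds
  obtain ⟨t, ⟨h1, h2⟩, h0⟩ := (((ht.eventually (Metric.ball_mem_nhds x hr)).and
    (ht.eventually (Metric.ball_mem_nhds x hr'))).and self_mem_nhdsWithin).exists
  have h0 : 0 < t := h0
  have e := (H _ h1).symm.trans (H' _ h2)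
  simp only [add_sub_cancel_left, inner_smul_right, inner_sub_right,
    real_inner_self_eq_norm_sq, hn, hn', real_inner_comm n n'] at e
  have := e.1 (by nlinarith)
  nlinarith

lemma HasNormal.normal_eq (h : HasNormal U x n) : normal U x = n := by
  have h' : ∃ n, HasNormal U x n := ⟨n, h⟩
  rw [normal, dif_pos h']
  exact h'.choose_spec.unique h

/-- For open `U` the frontier is the closure minus `U`. A point strictly on the outer side has a
neighbourhood missing `U`, and a point of the hyperplane is the limit of `y - t • n` as `t ↓ 0`. -/
lemma mem_frontier_iff_of_halfSpace (hU : IsOpen U) (hn : ‖n‖ = 1)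
    (H : ∀ y ∈ Metric.ball x r, (y ∈ U ↔ inner ℝ n (y - x) < 0)) (hy : y ∈ Metric.ball x r) :
    y ∈ frontier U ↔ inner ℝ n (y - x) = 0 := by
  rw [hU.frontier_eq, Set.mem_sdiff, H y hy, not_lt]
  refine ⟨fun ⟨h1, h2⟩ => le_antisymm ?_ h2, fun h => ⟨?_, h.ge⟩⟩
  · by_contra! h3
    have ho : IsOpen (Metric.ball x r ∩ {y | 0 < inner ℝ n (y - x)}) :=
      Metric.isOpen_ball.inter (isOpen_lt (by fun_prop) (by fun_prop))
    obtain ⟨w, ⟨hw1, hw2⟩, hw3⟩ := mem_closure_iff.1 h1 _ ho ⟨hy, h3⟩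
    exact lt_asymm hw2 ((H w hw1).1 hw3)
  · have ht : Tendsto (fun t : ℝ => y - t • n) (𝓝[>] 0) (𝓝 y) := by
      have : Continuous fun t : ℝ => y - t • n := by fun_prop
      simpa using (this.tendsto 0).mono_left nhdsWithin_le_nhds
    refine mem_closure_of_tendsto ht ?_
    filter_upwards [ht.eventually (Metric.isOpen_ball.mem_nhds hy), self_mem_nhdsWithin]
      with t ht1 ht2
    rw [H _ ht1, show y - t • n - x = (y - x) - t • n by abel, inner_sub_right, h,
      inner_smul_right, real_inner_self_eq_norm_sq, hn]
    have : 0 < t := ht2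
    linarith

lemma hasNormal_of_halfSpace (hU : IsOpen U) (hn : ‖n‖ = 1)
    (H : ∀ y ∈ Metric.ball x r, (y ∈ U ↔ inner ℝ n (y - x) < 0)) (hy : y ∈ Metric.ball x r)
    (h : inner ℝ n (y - x) = 0) : HasNormal U y n := by
  refine ⟨(mem_frontier_iff_of_halfSpace hU hn H hy).2 h, hn, r - dist y x, by
    rw [Metric.mem_ball] at hy; linarith, fun w hw => ?_⟩
  have hw' : w ∈ Metric.ball x r := by
    rw [Metric.mem_ball] at hw ⊢
    linarith [dist_triangle w y x]
  rw [H w hw', show w - x = (w - y) + (y - x) by abel, inner_add_right, h, add_zero]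

/-- In the ball of radius `r` about `x`, the sets `U` and `U' - z` are the two open half-balls cut
out by the hyperplane through `x` with normal `n`, which points out of `U`. -/
structure IsFace (U U' : Set (Space d)) (x z n : Space d) (r : ℝ) : Prop where
  pos : 0 < r
  norm_eq : ‖n‖ = 1
  mem_iff : ∀ y ∈ Metric.ball x r, (y ∈ U ↔ inner ℝ n (y - x) < 0)
  add_mem_iff : ∀ y ∈ Metric.ball x r, (y + z ∈ U' ↔ 0 < inner ℝ n (y - x))

lemma HasNormal.exists_isFace (h : HasNormal U x n) (h' : HasNormal U' (x + z) (-n)) :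
    ∃ r, IsFace U U' x z n r := by
  obtain ⟨-, hn, r, hr, H⟩ := h
  obtain ⟨-, -, r', hr', H'⟩ := h'
  refine ⟨min r r', lt_min hr hr', hn,
    fun y hy => H y (Metric.ball_subset_ball (min_le_left _ _) hy), fun y hy => ?_⟩
  have := Metric.ball_subset_ball (min_le_right r r') hy
  rw [H' (y + z) (by simpa [Metric.mem_ball] using this), add_sub_add_right_eq_sub,
    inner_neg_left, neg_lt_zero]

namespace IsFace

variable (h : IsFace U U' x z n r)
include h

lemma halfSpace' : ∀ y ∈ Metric.ball (x + z) r, (y ∈ U' ↔ inner ℝ (-n) (y - (x + z)) < 0) := by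
  intro y hy
  have := h.add_mem_iff (y - z) (by simpa [Metric.mem_ball, dist_eq_norm, sub_sub,
    add_comm] using hy)
  rw [sub_add_cancel] at this
  rw [this, inner_neg_left, neg_lt_zero, sub_sub, add_comm z x]

lemma mem_frontier_iff (hU : IsOpen U) (hy : y ∈ Metric.ball x r) :
    y ∈ frontier U ↔ inner ℝ n (y - x) = 0 :=
  mem_frontier_iff_of_halfSpace hU h.norm_eq h.mem_iff hy

lemma add_mem_frontier_iff (hU' : IsOpen U') (hy : y ∈ Metric.ball x r) :
    y + z ∈ frontier U' ↔ inner ℝ n (y - x) = 0 := by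
  rw [mem_frontier_iff_of_halfSpace hU' (by rw [norm_neg, h.norm_eq]) h.halfSpace'
    (by simpa [Metric.mem_ball] using hy), add_sub_add_right_eq_sub, inner_neg_left, neg_eq_zero]

lemma hasNormal (hU : IsOpen U) (hy : y ∈ Metric.ball x r) (hyU : y ∈ frontier U) :
    HasNormal U y n :=
  hasNormal_of_halfSpace hU h.norm_eq h.mem_iff hy ((h.mem_frontier_iff hU hy).1 hyU)

lemma hasNormal' (hU : IsOpen U) (hU' : IsOpen U') (hy : y ∈ Metric.ball x r)
    (hyU : y ∈ frontier U) : HasNormal U' (y + z) (-n) :=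
  hasNormal_of_halfSpace hU' (by rw [norm_neg, h.norm_eq]) h.halfSpace'
    (by simpa [Metric.mem_ball] using hy) (by
      rw [add_sub_add_right_eq_sub, inner_neg_left, (h.mem_frontier_iff hU hy).1 hyU, neg_zero])

/-- Translation is an isometry, hence preserves Hausdorff measure, and inside the ball it matches
the two frontiers because both are the same hyperplane. -/
lemma measurePreserving (hU : IsOpen U) (hU' : IsOpen U') :
    MeasurePreserving (fun y => y + z) ((bdry U).restrict (Metric.ball x r))
      ((bdry U').restrict (Metric.ball (x + z) r)) := by
  rw [bdry, bdry, Measure.restrict_restrict measurableSet_ball,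
    Measure.restrict_restrict measurableSet_ball]
  have e : Metric.ball x r ∩ frontier U =
      (fun y => y + z) ⁻¹' (Metric.ball (x + z) r ∩ frontier U') := by
    ext y
    have hb : y + z ∈ Metric.ball (x + z) r ↔ y ∈ Metric.ball x r := by simp [Metric.mem_ball]
    simp only [mem_inter_iff, mem_preimage, hb]
    exact and_congr_right fun hy => by
      rw [h.mem_frontier_iff hU hy, h.add_mem_frontier_iff hU' hy]
  rw [e]
  exact ((IsometryEquiv.addRight z).measurePreserving_euclideanHausdorffMeasure (d - 1)).restrict_preimage
    (measurableSet_ball.inter isClosed_frontier.measurableSet)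

lemma integral_bdry {E : Type*} [NormedAddCommGroup E] [NormedSpace ℝ E]
    (hU : IsOpen U) (hU' : IsOpen U') {F : Space d → E}
    (hF : ∀ y ∉ Metric.ball (x + z) r, F y = 0) :
    ∫ y, F y ∂(bdry U') = ∫ y in Metric.ball x r, F (y + z) ∂(bdry U) := by
  rw [← setIntegral_eq_integral_of_forall_compl_eq_zero hF]
  exact ((h.measurePreserving hU hU').integral_comp
    (MeasurableEquiv.addRight z).measurableEmbedding F).symm

/-- An integral over the ball splits into the integrals over the two half-balls. -/
lemma integral_eq_add {E : Type*} [NormedAddCommGroup E] [NormedSpace ℝ E]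
    (hU : IsOpen U) (hU' : IsOpen U') {F : Space d → E}
    (hF : ∀ y ∉ Metric.ball x r, F y = 0) (hi : IntegrableOn F U)
    (hi' : IntegrableOn (fun y => F (y - z)) U') :
    ∫ y, F y = (∫ y in U, F y) + ∫ y in U', F (y - z) := by
  set F' : Space d → E := U'.indicator fun y => F (y - z) with hF'
  have hi'' : Integrable F' := (integrable_indicator_iff hU'.measurableSet).2 hi'
  rw [← integral_indicator hU.measurableSet, ← integral_indicator hU'.measurableSet, ← hF',
    ← integral_add_right_eq_self F' z,
    ← integral_add ((integrable_indicator_iff hU.measurableSet).2 hi) (hi''.comp_add_right z)]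
  -- Only the separating hyperplane is missed by the two half-balls; it is null because `n ≠ 0`
  -- makes its direction a proper subspace.
  have hnull : volume {y : Space d | inner ℝ n (y - x) = 0} = 0 := by
    have e : {y : Space d | inner ℝ n (y - x) = 0} =
        (fun y => y + -x) ⁻¹' ((LinearMap.ker (innerSL ℝ n : Space d →L[ℝ] ℝ).toLinearMap :
          Submodule ℝ (Space d)) : Set (Space d)) := by
      ext y; simp [sub_eq_add_neg]
    rw [e, measure_preimage_add_right]
    refine Measure.addHaar_submodule _ _ fun ht => ?_
    have : n ∈ LinearMap.ker (innerSL ℝ n : Space d →L[ℝ] ℝ).toLinearMap := by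
      rw [ht]; trivial
    simp at this
    have h1 := h.norm_eq
    simp [this] at h1
  refine integral_congr_ae ?_
  filter_upwards [measure_eq_zero_iff_ae_notMem.1 hnull] with y hy
  by_cases hyb : y ∈ Metric.ball x r
  · have hy : inner ℝ n (y - x) ≠ 0 := hy
    rcases lt_or_gt_of_ne hy with h1 | h1
    · simp [F', (h.mem_iff y hyb).2 h1,
        show y + z ∉ U' from fun h2 => lt_asymm h1 ((h.add_mem_iff y hyb).1 h2)]
    · simp [F', (h.add_mem_iff y hyb).2 h1,
        show y ∉ U from fun h2 => lt_asymm h1 ((h.mem_iff y hyb).1 h2)]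
  · have e : F' (y + z) = 0 := Set.indicator_apply_eq_zero.2 fun _ => by
      rw [add_sub_cancel_right, hF y hyb]
    rw [hF y hyb, Set.indicator_apply_eq_zero.2 fun _ => hF y hyb, e, add_zero]

end IsFace

end Geometry

/-! ### Faces of the periodic mesh and uniqueness of the neighbour across a face. -/

section MeshGeometry

variable {d : ℕ} {ι : Type*} [Fintype ι] (T : PeriodicMesh d ι) {k k' : ι} {x z n : Space d} {r : ℝ}

/-- Distinct lattice translates of the open cube are disjoint: each coordinate of `z` is an integer
strictly between `-1` and `1`. -/
lemma eq_zero_of_mem_lattice_of_mem_cube {y : Space d} (hz : z ∈ lattice d) (hy : y ∈ cube d)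
    (hyz : y + z ∈ cube d) : z = 0 := by
  ext i
  obtain ⟨m, hm⟩ := hz i
  have h1 := hy i
  have h2 := hyz i
  simp only [PiLp.add_apply, hm] at h2
  have h3 : (m : ℝ) < 1 := by linarith
  have h4 : (-1 : ℝ) < m := by linarith
  have h5 : m < 1 := by exact_mod_cast h3
  have h6 : -1 < m := by exact_mod_cast h4
  have : m = 0 := by omega
  simp [hm, this]

lemma sub_mem_lattice {z' : Space d} (hz : z ∈ lattice d) (hz' : z' ∈ lattice d) :
    z - z' ∈ lattice d := by
  intro i
  obtain ⟨m, hm⟩ := hz i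
  obtain ⟨m', hm'⟩ := hz' i
  exact ⟨m - m', by simp [hm, hm']⟩

lemma neg_mem_lattice (hz : z ∈ lattice d) : -z ∈ lattice d := by
  simpa using sub_mem_lattice (z := 0) (fun i => ⟨0, by simp⟩) hz

lemma countable_lattice : (lattice d).Countable := by
  refine (countable_range fun m : Fin d → ℤ => WithLp.toLp 2 fun i => (m i : ℝ)).mono fun z hz => ?_
  choose m hm using hz
  exact ⟨m, by ext i; simp [hm]⟩

namespace PeriodicMesh

lemma exists_isFace {p : ι × Space d} (hp : p ∈ T.across k x) :
    ∃ n r, IsFace (T.elem k) (T.elem p.1) x (p.2 - x) n r := by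
  obtain ⟨-, n, h1, h2⟩ := hp
  obtain ⟨r, hr⟩ := h1.exists_isFace (z := p.2 - x) (by simpa using h2)
  exact ⟨n, r, hr⟩

/-- A point slightly outside element `k`, along the normal, lies in both candidate neighbours after
translation. Both translates lie in the open cube, so the two periods agree, and disjointness of the
elements identifies the neighbours. This makes the `finsum` in the jumps a single term. -/
lemma across_unique {p q : ι × Space d} (hp : p ∈ T.across k x) (hq : q ∈ T.across k x) :
    p = q := by
  obtain ⟨n, h1⟩ := hp.2
  obtain ⟨n', h1'⟩ := hq.2
  obtain rfl := h1.1.unique h1'.1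
  obtain ⟨r, hf⟩ := h1.1.exists_isFace (z := p.2 - x) (by simpa using h1.2)
  obtain ⟨r', hf'⟩ := h1.1.exists_isFace (z := q.2 - x) (by simpa using h1'.2)
  have ht : Tendsto (fun t : ℝ => x + t • n) (𝓝[>] 0) (𝓝 x) := by
    have : Continuous fun t : ℝ => x + t • n := by fun_prop
    simpa using (this.tendsto 0).mono_left nhdsWithin_le_nhds
  obtain ⟨t, ⟨h2, h2'⟩, h0⟩ := (((ht.eventually (Metric.ball_mem_nhds x hf.pos)).and
    (ht.eventually (Metric.ball_mem_nhds x hf'.pos))).and self_mem_nhdsWithin).exists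
  have hpos : 0 < inner ℝ n (x + t • n - x) := by
    have h0 : 0 < t := h0
    simpa [inner_smul_right, hf.norm_eq] using h0
  have h3 := (hf.add_mem_iff _ h2).2 hpos
  have h3' := (hf'.add_mem_iff _ h2').2 hpos
  have hz : q.2 - x - (p.2 - x) = 0 :=
    eq_zero_of_mem_lattice_of_mem_cube (sub_mem_lattice hq.1 hp.1) (T.subset_cube _ h3) (by
      rw [add_assoc, add_sub_cancel]; exact T.subset_cube _ h3')
  have hz' : q.2 - x = p.2 - x := sub_eq_zero.1 hz
  have e2 : p.2 = q.2 := (sub_left_injective hz').symm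
  rw [hz'] at h3'
  refine Prod.ext ?_ e2
  by_contra hne
  exact disjoint_left.1 (T.disjoint hne) h3 h3'

end PeriodicMesh

lemma IsFace.mem_across {T : PeriodicMesh d ι} (h : IsFace (T.elem k) (T.elem k') x z n r)
    (hz : z ∈ lattice d) {y : Space d} (hy : y ∈ Metric.ball x r)
    (hyU : y ∈ frontier (T.elem k)) : (k', y + z) ∈ T.across k y :=
  ⟨by simpa using hz, n, h.hasNormal (T.isOpen k) hy hyU,
    h.hasNormal' (T.isOpen k) (T.isOpen k') hy hyU⟩

lemma PeriodicMesh.finsum_across_eq {T : PeriodicMesh d ι} {p : ι × Space d} (hp : p ∈ T.across k x)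
    {E : Type*} [AddCommMonoid E] (f : ι × Space d → E) : ∑ᶠ q ∈ T.across k x, f q = f p := by
  have : T.across k x = {p} := by
    ext q
    exact ⟨fun hq => T.across_unique hq hp, fun hq => by rw [mem_singleton_iff.1 hq]; exact hp⟩
  rw [this, finsum_mem_singleton]

lemma IsFace.finsum_across {T : PeriodicMesh d ι} (h : IsFace (T.elem k) (T.elem k') x z n r)
    (hz : z ∈ lattice d) {y : Space d} (hy : y ∈ Metric.ball x r)
    (hyU : y ∈ frontier (T.elem k)) {E : Type*} [AddCommMonoid E] (f : ι × Space d → E) :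
    ∑ᶠ p ∈ T.across k y, f p = f (k', y + z) :=
  PeriodicMesh.finsum_across_eq (h.mem_across hz hy hyU) f

lemma PeriodicMesh.mem_neighbors {p : ι × Space d} (hp : p ∈ T.across k x) :
    p.1 ∈ T.neighbors k := by
  simp only [PeriodicMesh.neighbors, Finset.mem_filter, Finset.mem_univ, true_and]
  exact ⟨x, p, hp, rfl⟩

lemma PeriodicMesh.self_mem_patch (k : ι) : k ∈ T.patch k := by
  simp [PeriodicMesh.patch]

lemma PeriodicMesh.mem_patch_of_mem_neighbors (hk : k' ∈ T.neighbors k) : k' ∈ T.patch k := by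
  simp [PeriodicMesh.patch, hk]

lemma IsFace.self_mem_frontier (h : IsFace (T.elem k) (T.elem k') x z n r) :
    x ∈ frontier (T.elem k) :=
  (h.mem_frontier_iff (T.isOpen k) (Metric.mem_ball_self h.pos)).2 (by simp)

lemma IsFace.mem_neighbors (h : IsFace (T.elem k) (T.elem k') x z n r) (hz : z ∈ lattice d) :
    k' ∈ T.neighbors k :=
  T.mem_neighbors (h.mem_across hz (Metric.mem_ball_self h.pos) (h.self_mem_frontier T))

/-- A property that holds almost everywhere near each face point holds almost everywhere. -/
lemma PeriodicMesh.ae_bdry_of_forall_isFace {P : Space d → Prop}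
    (h : ∀ x k' z n r, z ∈ lattice d → IsFace (T.elem k) (T.elem k') x z n r →
      ∀ᵐ y ∂(bdry (T.elem k)), y ∈ Metric.ball x r → P y) :
    ∀ᵐ y ∂(bdry (T.elem k)), P y := by
  -- Every point that has a neighbour across has a ball in which the exceptional set is null, and a
  -- locally null set is null by second countability.
  have key : bdry (T.elem k) {y | ¬ P y ∧ (T.across k y).Nonempty} = 0 := by
    refine measure_null_of_locally_null _ fun x hx => ?_
    obtain ⟨p, hp⟩ := hx.2
    obtain ⟨n, r, hf⟩ := T.exists_isFace hp
    refine ⟨Metric.ball x r ∩ {y | ¬ P y ∧ (T.across k y).Nonempty},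
      inter_mem (mem_nhdsWithin_of_mem_nhds (Metric.ball_mem_nhds x hf.pos)) self_mem_nhdsWithin,
      measure_mono_null (fun y hy => ?_) (ae_iff.1 (h x p.1 _ n r hp.1 hf))⟩
    exact fun hc => hy.2.1 (hc hy.1)
  filter_upwards [measure_eq_zero_iff_ae_notMem.1 key, T.exists_across k] with y hy hy'
  by_contra hP
  exact hy ⟨hP, hy'⟩

end MeshGeometry

/-! ### Continuity of the exact solution and of its flux across a face. -/

section Conforming

variable {d : ℕ} {U U' : Set (Space d)} {x z n : Space d} {r : ℝ}

/-! ### The exact solution on a single element -/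

lemma IsPotential.aestronglyMeasurable {V : Space d → ℝ} (hV : IsPotential V) (hU : IsOpen U)
    (hUc : U ⊆ cube d) : AEStronglyMeasurable V (volume.restrict U) :=
  (hV.smooth.continuousOn.mono hUc).aestronglyMeasurable hU.measurableSet

lemma IsPotential.memLp_mul {V : Space d → ℝ} (hV : IsPotential V) (hU : IsOpen U)
    (hUc : U ⊆ cube d) {v : Space d → ℝ} (hv : MemLp v 2 (volume.restrict U)) :
    MemLp (fun x => V x * v x) 2 (volume.restrict U) := by
  obtain ⟨C, hC⟩ := hV.bounded
  refine hv.of_le_mul (c := C) ((hV.aestronglyMeasurable hU hUc).mul hv.1) ?_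
  filter_upwards [ae_restrict_mem hU.measurableSet] with x hx
  rw [norm_mul, Real.norm_of_nonneg (hV.pos x (hUc hx)).le]
  exact mul_le_mul_of_nonneg_right (hC x (hUc hx)) (norm_nonneg _)

lemma IsPeriodicGrad.isWeakGrad {u : Space d → ℝ} {G : Space d → Space d}
    (h : IsPeriodicGrad u G) (hUc : U ⊆ cube d) : IsWeakGrad U u G := by
  refine ⟨h.memLp.mono_measure (Measure.restrict_mono_set _ hUc),
    h.memLp_grad.mono_measure (Measure.restrict_mono_set _ hUc), fun χ hχ => ?_⟩
  rw [setIntegral_eq_integral_of_forall_compl_eq_zero fun x hx => by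
      rw [hχ.gradient_eq_zero hx, smul_zero],
    setIntegral_eq_integral_of_forall_compl_eq_zero fun x hx => by rw [hχ.eq_zero hx, zero_smul]]
  exact h.weak χ (hχ.mono (subset_univ U))

/-- Test functions on `U` are test functions on the whole space that vanish off `U`, so the global
equation localises directly to the element and reads `Δu = V u - lam u` there. -/
lemma isWeakLap_of_weak_equation (hU : IsOpen U) (hUc : U ⊆ cube d) {V : Space d → ℝ}
    (hV : IsPotential V) {lam : ℝ} {u : Space d → ℝ} {G : Space d → Space d}
    (h : IsPeriodicGrad u G)
    (heq : ∀ χ, IsTest univ χ →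
      (∫ x, inner ℝ (G x) (gradient χ x)) + ∫ x, V x * u x * χ x = lam * ∫ x, u x * χ x) :
    IsWeakLap U u (fun x => V x * u x - lam * u x) := by
  have hw := h.isWeakGrad hUc
  have hVu := hV.memLp_mul hU hUc hw.1
  refine ⟨hw.memH1, hVu.sub (hw.1.const_mul lam), fun χ hχ => ?_⟩
  have e : ∫ x in U, inner ℝ (wgrad U u x) (gradient χ x) =
      ∫ x in U, inner ℝ (G x) (gradient χ x) :=
    integral_congr_ae ((hw.wgrad_ae hU).mono fun x hx => by simp only [hx])
  have e' := heq χ (hχ.mono (subset_univ U))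
  have restr : ∀ f : Space d → ℝ, (∀ x ∉ U, f x = 0) → ∫ x, f x = ∫ x in U, f x := fun f hf =>
    (setIntegral_eq_integral_of_forall_compl_eq_zero hf).symm
  rw [restr _ fun x hx => by rw [hχ.gradient_eq_zero hx, inner_zero_right],
    restr (fun x => V x * u x * χ x) fun x hx => by rw [hχ.eq_zero hx, mul_zero],
    restr (fun x => u x * χ x) fun x hx => by rw [hχ.eq_zero hx, mul_zero]] at e'
  simp only [e, sub_mul, mul_assoc lam]
  rw [integral_sub (integrable_mul_of_memLp hVu (hχ.memLp 2))
    ((integrable_mul_of_memLp hw.1 (hχ.memLp 2)).const_mul lam), integral_const_mul]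
  linarith

/-! ### Conservation across a face -/

/-- Two functions on the two sides of a face agree up to the factor `c` if they do so when tested
against functions supported near the face. -/
lemma IsFace.ae_eq_of_forall_isTest (h : IsFace U U' x z n r) (hU : IsOpen U) (hU' : IsOpen U')
    [IsFiniteMeasure (bdry U)] [IsFiniteMeasure (bdry U')] {s s' : Space d → ℝ} (c : ℝ)
    (hs : MemLp s 2 (bdry U)) (hs' : MemLp s' 2 (bdry U'))
    (H : ∀ χ, IsTest (Metric.ball x r) χ →
      ∫ y, s y * χ y ∂(bdry U) = c * ∫ y, s' y * χ (y - z) ∂(bdry U')) :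
    ∀ᵐ y ∂(bdry U), y ∈ Metric.ball x r → s y = c * s' (y + z) := by
  set μ := (bdry U).restrict (Metric.ball x r) with hμ
  have h1 : MemLp s 2 μ := hs.restrict _
  have h2 : MemLp (fun y => c * s' (y + z)) 2 μ :=
    ((hs'.restrict (Metric.ball (x + z) r)).comp_measurePreserving
      (h.measurePreserving hU hU')).const_mul c
  have := Metric.isOpen_ball.ae_eq_zero_of_integral_contDiff_smul_eq_zero (μ := μ)
    (f := s - fun y => c * s' (y + z)) (U := Metric.ball x r)
    (((h1.sub h2).integrable (by norm_num)).locallyIntegrable.locallyIntegrableOn _)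
    fun χ hχ1 hχ2 hχ3 => by
      have hχ : IsTest (Metric.ball x r) χ := ⟨hχ1, hχ2, hχ3⟩
      have hχL : MemLp χ 2 μ := hχ.continuous.memLp_of_hasCompactSupport hχ2
      have e := H χ hχ
      rw [← setIntegral_eq_integral_of_forall_compl_eq_zero (s := Metric.ball x r) fun y hy => by
          rw [hχ.eq_zero hy, mul_zero],
        h.integral_bdry hU hU' fun y hy => by
          rw [hχ.eq_zero (by simpa [Metric.mem_ball, dist_eq_norm, sub_sub, add_comm] using hy),
            mul_zero]] at e
      simp only [add_sub_cancel_right] at e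
      simp only [Pi.sub_apply, smul_eq_mul, mul_comm (χ _), sub_mul, mul_assoc c]
      rw [integral_sub (integrable_mul_of_memLp h1 hχL), integral_const_mul, e, sub_self]
      simp only [← mul_assoc c]
      exact integrable_mul_of_memLp h2 hχL
  filter_upwards [ae_imp_of_ae_restrict this] with y hy hyb
  exact sub_eq_zero.1 (hy hyb hyb)

/-- Green's formula for a sum of two functions with traces, tested near a flat boundary piece. -/
lemma green_trace_add (hU : IsOpen U) [IsFiniteMeasure (bdry U)] {u w : Space d → ℝ}
    {G : Space d → Space d} (hu : IsWeakGrad U u G) (he : HasTrace U (u - w)) (hw : HasTrace U w)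
    {χ : Space d → ℝ} (hχ : ContDiff ℝ ∞ χ) (hχc : HasCompactSupport χ)
    (hn : ∀ y ∈ frontier U, χ y ≠ 0 → normal U y = n) :
    (∫ y in U, u y • gradient χ y) + ∫ y in U, χ y • G y =
      (∫ y, (trace U (u - w) + trace U w) y * χ y ∂(bdry U)) • n := by
  have hχL : MemLp χ 2 (volume.restrict U) :=
    (hχ.continuous.memLp_of_hasCompactSupport hχc).restrict U
  have hχG : MemLp (gradient χ) 2 (volume.restrict U) :=
    ((continuous_gradient hχ).memLp_of_hasCompactSupport (hasCompactSupport_gradient hχc)).restrict U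
  have hχB : MemLp χ 2 (bdry U) := hχ.continuous.memLp_of_hasCompactSupport hχc
  have hflat : ∀ τ : Space d → ℝ, ∫ y, (τ y * χ y) • normal U y ∂(bdry U) =
      (∫ y, τ y * χ y ∂(bdry U)) • n := fun τ => by
    rw [← integral_smul_const]
    refine integral_congr_ae ?_
    filter_upwards [ae_restrict_mem (μ := μHE[d - 1]) (isClosed_frontier (s := U)).measurableSet]
      with y hy
    by_cases h0 : χ y = 0
    · simp [h0]
    · rw [hn y hy h0]
  have hgreen : ∀ v : Space d → ℝ, HasTrace U v →
      (∫ y in U, v y • gradient χ y) + ∫ y in U, χ y • wgrad U v y =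
        (∫ y, trace U v y * χ y ∂(bdry U)) • n := fun v hv => by
    rw [← hflat, ← hv.isTrace.2.2 χ hχ]
    exact (integral_add (integrable_smul_of_memLp hv.memH1.isWeakGrad.1 hχG)
      (integrable_smul_of_memLp hχL hv.memH1.isWeakGrad.2.1)).symm
  have e1 := hgreen _ he
  have e2 := hgreen _ hw
  have i1 : ∫ y in U, χ y • wgrad U (u - w) y =
      (∫ y in U, χ y • G y) - ∫ y in U, χ y • wgrad U w y := by
    rw [← integral_sub (integrable_smul_of_memLp hχL hu.2.1)
      (integrable_smul_of_memLp hχL hw.memH1.isWeakGrad.2.1)]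
    exact integral_congr_ae (((hu.sub hw.memH1.isWeakGrad).wgrad_ae hU).mono fun y hy => by
      simp only [hy, Pi.sub_apply, smul_sub])
  have i2 : ∫ y in U, (u - w) y • gradient χ y =
      (∫ y in U, u y • gradient χ y) - ∫ y in U, w y • gradient χ y := by
    rw [← integral_sub (integrable_smul_of_memLp hu.1 hχG)
      (integrable_smul_of_memLp hw.memH1.isWeakGrad.1 hχG)]
    simp only [Pi.sub_apply, sub_smul]
  have i3 : ∫ y, (trace U (u - w) + trace U w) y * χ y ∂(bdry U) =
      (∫ y, trace U (u - w) y * χ y ∂(bdry U)) + ∫ y, trace U w y * χ y ∂(bdry U) := by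
    rw [← integral_add (integrable_mul_of_memLp he.isTrace.2.1 hχB)
      (integrable_mul_of_memLp hw.isTrace.2.1 hχB)]
    simp only [Pi.add_apply, add_mul]
  rw [i3, add_smul, ← e1, ← e2, i1, i2]
  abel

/-- Green's formula for a sum of two functions with normal derivatives. -/
lemma green_normalDeriv_add (hU : IsOpen U) [IsFiniteMeasure (bdry U)] {u w f : Space d → ℝ}
    {G : Space d → Space d} (hu : IsWeakGrad U u G) (hf : IsWeakLap U u f)
    (he : HasNormalDeriv U (u - w)) (hw : HasNormalDeriv U w)
    {χ : Space d → ℝ} (hχ : ContDiff ℝ ∞ χ) (hχc : HasCompactSupport χ) :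
    (∫ y in U, inner ℝ (G y) (gradient χ y)) + ∫ y in U, f y * χ y =
      ∫ y, (normalDeriv U (u - w) + normalDeriv U w) y * χ y ∂(bdry U) := by
  have hχL : MemLp χ 2 (volume.restrict U) :=
    (hχ.continuous.memLp_of_hasCompactSupport hχc).restrict U
  have hχG : MemLp (gradient χ) 2 (volume.restrict U) :=
    ((continuous_gradient hχ).memLp_of_hasCompactSupport (hasCompactSupport_gradient hχc)).restrict U
  have hχB : MemLp χ 2 (bdry U) := hχ.continuous.memLp_of_hasCompactSupport hχc
  have hwL := isWeakLap_wlap hw.isNormalDeriv.1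
  have heL := isWeakLap_wlap he.isNormalDeriv.1
  simp only [Pi.add_apply, add_mul]
  rw [integral_add (integrable_mul_of_memLp he.isNormalDeriv.2.1 hχB)
    (integrable_mul_of_memLp hw.isNormalDeriv.2.1 hχB), ← he.isNormalDeriv.2.2 χ hχ,
    ← hw.isNormalDeriv.2.2 χ hχ, ← integral_add, ← integral_add]
  · refine integral_congr_ae ?_
    filter_upwards [(hu.sub hwL.1.isWeakGrad).wgrad_ae hU, (hf.sub hU hwL).wlap_ae hU]
      with y h1 h2
    simp only [h1, h2, Pi.sub_apply, inner_sub_left, sub_mul]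
    abel
  · exact (integrable_inner_of_memLp heL.1.isWeakGrad.2.1 hχG).add
      (integrable_mul_of_memLp heL.2.1 hχL)
  · exact (integrable_inner_of_memLp hwL.1.isWeakGrad.2.1 hχG).add
      (integrable_mul_of_memLp hwL.2.1 hχL)
  · exact integrable_inner_of_memLp hu.2.1 hχG
  · exact integrable_mul_of_memLp hf.2.1 hχL

lemma IsPeriodic.apply_sub {X : Type*} {f : Space d → X} (hf : IsPeriodic f) (hz : z ∈ lattice d)
    (y : Space d) : f (y - z) = f y := by
  rw [sub_eq_add_neg]; exact hf y _ (neg_mem_lattice hz)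

lemma IsTest.comp_sub {χ : Space d → ℝ} (hχ : IsTest U χ) :
    ContDiff ℝ ∞ (fun y => χ (y - z)) ∧ HasCompactSupport fun y => χ (y - z) :=
  ⟨hχ.1.comp (contDiff_id.sub contDiff_const), by
    simpa [Homeomorph.subRight] using! hχ.2.1.comp_homeomorph (Homeomorph.subRight z)⟩

/-- The sum of the two traces plays the part of the trace of `u`. Green's formula is applied on `U`
with `χ` and on `U'` with the shifted `χ`. By periodicity the volume terms add up to an integral
over the whole space, which vanishes by the definition of the weak gradient of `u`; the opposite
normals then leave the difference of the two boundary integrals, times `n`. -/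
lemma IsFace.trace_add_ae_eq (h : IsFace U U' x z n r) (hU : IsOpen U) (hU' : IsOpen U')
    [IsFiniteMeasure (bdry U)] [IsFiniteMeasure (bdry U')] (hUc : U ⊆ cube d)
    (hUc' : U' ⊆ cube d) (hz : z ∈ lattice d) {u w : Space d → ℝ} {G : Space d → Space d}
    (hu : IsPeriodicGrad u G) (he : HasTrace U (u - w)) (hw : HasTrace U w)
    (he' : HasTrace U' (u - w)) (hw' : HasTrace U' w) :
    ∀ᵐ y ∂(bdry U), y ∈ Metric.ball x r →
      (trace U (u - w) + trace U w) y = (trace U' (u - w) + trace U' w) (y + z) := by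
  have := h.ae_eq_of_forall_isTest hU hU' 1 (he.isTrace.2.1.add hw.isTrace.2.1)
    (he'.isTrace.2.1.add hw'.isTrace.2.1) fun χ hχ => by
      have g1 := hu.isWeakGrad hUc
      have g2 := hu.isWeakGrad hUc'
      have e1 := green_trace_add (n := n) hU g1 he hw hχ.1 hχ.2.1 fun y hy hχy =>
        (h.hasNormal hU (by by_contra hc; exact hχy (hχ.eq_zero hc)) hy).normal_eq
      have e2 := green_trace_add (n := -n) hU' g2 he' hw' (hχ.comp_sub (z := z)).1
        (hχ.comp_sub (z := z)).2 fun y hy hχy => by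
          have hb : y - z ∈ Metric.ball x r := by by_contra hc; exact hχy (hχ.eq_zero hc)
          have := h.hasNormal' hU hU' hb (by
            rw [h.mem_frontier_iff hU hb, ← h.add_mem_frontier_iff hU' hb, sub_add_cancel]
            exact hy)
          rw [sub_add_cancel] at this
          exact this.normal_eq
      have hχL : MemLp χ 2 (volume.restrict U) :=
        (hχ.1.continuous.memLp_of_hasCompactSupport hχ.2.1).restrict U
      have hχG : MemLp (gradient χ) 2 (volume.restrict U) :=
        ((continuous_gradient hχ.1).memLp_of_hasCompactSupport
          (hasCompactSupport_gradient hχ.2.1)).restrict U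
      have hχL' : MemLp (fun y => χ (y - z)) 2 (volume.restrict U') :=
        (hχ.comp_sub.1.continuous.memLp_of_hasCompactSupport hχ.comp_sub.2).restrict U'
      have hχG' : MemLp (gradient fun y => χ (y - z)) 2 (volume.restrict U') :=
        ((continuous_gradient hχ.comp_sub.1).memLp_of_hasCompactSupport
          (hasCompactSupport_gradient hχ.comp_sub.2)).restrict U'
      have s1 := h.integral_eq_add (F := fun y => u y • gradient χ y) hU hU'
        (fun y hy => by rw [hχ.gradient_eq_zero hy, smul_zero])
        (integrable_smul_of_memLp g1.1 hχG)
        (by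
          simp only [hu.periodic.apply_sub hz, ← gradient_comp_sub]
          exact integrable_smul_of_memLp g2.1 hχG')
      have s2 := h.integral_eq_add (F := fun y => χ y • G y) hU hU'
        (fun y hy => by rw [hχ.eq_zero hy, zero_smul])
        (integrable_smul_of_memLp hχL g1.2.1)
        (by
          simp only [hu.periodic_grad.apply_sub hz]
          exact integrable_smul_of_memLp hχL' g2.2.1)
      have s3 := hu.weak χ (hχ.mono (subset_univ _))
      simp only [hu.periodic.apply_sub hz, hu.periodic_grad.apply_sub hz,
        ← gradient_comp_sub] at s1 s2
      rw [s1, s2] at s3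
      have s4 := congrArg₂ (· + ·) e1 e2
      -- The identity is vector valued but parallel to `n`; since `n ≠ 0`, the scalar factor is
      -- zero.
      have hsum : ((∫ y, (trace U (u - w) + trace U w) y * χ y ∂(bdry U)) -
          ∫ y, (trace U' (u - w) + trace U' w) y * χ (y - z) ∂(bdry U')) • n = 0 := by
        rw [sub_smul, sub_eq_add_neg, ← smul_neg, ← s4, ← sub_eq_zero.2 s3]
        abel
      have hn0 : n ≠ 0 := by
        intro h0
        have := h.norm_eq
        simp [h0] at this
      rw [one_mul]
      exact sub_eq_zero.1 ((smul_eq_zero.1 hsum).resolve_right hn0)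
  simpa only [one_mul] using this

/-- As for the traces, with the weak eigenvalue equation replacing the definition of the weak
gradient. Each normal derivative is taken with the exterior normal of its own element, so flux
continuity appears with the factor `-1`. -/
lemma IsFace.normalDeriv_add_ae_eq (h : IsFace U U' x z n r) (hU : IsOpen U) (hU' : IsOpen U')
    [IsFiniteMeasure (bdry U)] [IsFiniteMeasure (bdry U')] (hUc : U ⊆ cube d)
    (hUc' : U' ⊆ cube d) (hz : z ∈ lattice d) {V : Space d → ℝ} (hV : IsPotential V) {lam : ℝ}
    {u w : Space d → ℝ} {G : Space d → Space d} (hu : IsPeriodicGrad u G)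
    (heq : ∀ χ, IsTest univ χ →
      (∫ x, inner ℝ (G x) (gradient χ x)) + ∫ x, V x * u x * χ x = lam * ∫ x, u x * χ x)
    (he : HasNormalDeriv U (u - w)) (hw : HasNormalDeriv U w)
    (he' : HasNormalDeriv U' (u - w)) (hw' : HasNormalDeriv U' w) :
    ∀ᵐ y ∂(bdry U), y ∈ Metric.ball x r →
      (normalDeriv U (u - w) + normalDeriv U w) y =
        -1 * (normalDeriv U' (u - w) + normalDeriv U' w) (y + z) := by
  refine h.ae_eq_of_forall_isTest hU hU' (-1)
    (he.isNormalDeriv.2.1.add hw.isNormalDeriv.2.1)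
    (he'.isNormalDeriv.2.1.add hw'.isNormalDeriv.2.1) fun χ hχ => ?_
  have g1 := hu.isWeakGrad hUc
  have g2 := hu.isWeakGrad hUc'
  have e1 := green_normalDeriv_add hU g1 (isWeakLap_of_weak_equation hU hUc hV hu heq) he hw
    hχ.1 hχ.2.1
  have e2 := green_normalDeriv_add hU' g2 (isWeakLap_of_weak_equation hU' hUc' hV hu heq) he' hw'
    (hχ.comp_sub (z := z)).1 (hχ.comp_sub (z := z)).2
  have hχL : MemLp χ 2 (volume.restrict U) :=
    (hχ.1.continuous.memLp_of_hasCompactSupport hχ.2.1).restrict U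
  have hχG : MemLp (gradient χ) 2 (volume.restrict U) :=
    ((continuous_gradient hχ.1).memLp_of_hasCompactSupport
      (hasCompactSupport_gradient hχ.2.1)).restrict U
  have hχL' : MemLp (fun y => χ (y - z)) 2 (volume.restrict U') :=
    (hχ.comp_sub.1.continuous.memLp_of_hasCompactSupport hχ.comp_sub.2).restrict U'
  have hχG' : MemLp (gradient fun y => χ (y - z)) 2 (volume.restrict U') :=
    ((continuous_gradient hχ.comp_sub.1).memLp_of_hasCompactSupport
      (hasCompactSupport_gradient hχ.comp_sub.2)).restrict U'
  have iV := integrable_mul_of_memLp (hV.memLp_mul hU hUc g1.1) hχL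
  have iV' := integrable_mul_of_memLp (hV.memLp_mul hU' hUc' g2.1) hχL'
  have iu := integrable_mul_of_memLp g1.1 hχL
  have iu' := integrable_mul_of_memLp g2.1 hχL'
  have s1 := h.integral_eq_add (F := fun y => inner ℝ (G y) (gradient χ y)) hU hU'
    (fun y hy => by rw [hχ.gradient_eq_zero hy, inner_zero_right])
    (integrable_inner_of_memLp g1.2.1 hχG)
    (by
      simp only [hu.periodic_grad.apply_sub hz, ← gradient_comp_sub]
      exact integrable_inner_of_memLp g2.2.1 hχG')
  have s2 := h.integral_eq_add (F := fun y => V y * u y * χ y) hU hU'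
    (fun y hy => by rw [hχ.eq_zero hy, mul_zero]) iV
    (by
      simp only [hu.periodic.apply_sub hz, hV.periodic.apply_sub hz]
      exact iV')
  have s3 := h.integral_eq_add (F := fun y => u y * χ y) hU hU'
    (fun y hy => by rw [hχ.eq_zero hy, mul_zero]) iu
    (by
      simp only [hu.periodic.apply_sub hz]
      exact iu')
  have s4 := heq χ (hχ.mono (subset_univ _))
  simp only [hu.periodic.apply_sub hz, hu.periodic_grad.apply_sub hz, hV.periodic.apply_sub hz,
    ← gradient_comp_sub] at s1 s2 s3
  simp only [sub_mul, mul_assoc lam] at e1 e2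
  rw [integral_sub iV (iu.const_mul lam), integral_const_mul] at e1
  rw [integral_sub iV' (iu'.const_mul lam), integral_const_mul] at e2
  rw [s1, s2, s3] at s4
  rw [← e1, ← e2]
  linarith

end Conforming

/-! ### Jumps of the error, and the face and jump estimators. -/

section Jumps

variable {d : ℕ} {ι : Type*} [Fintype ι] {T : PeriodicMesh d ι} {k : ι}

/-! ### Jumps of the error and of the discrete solution -/

instance PeriodicMesh.isFiniteMeasure_bdry (T : PeriodicMesh d ι) (k : ι) :
    IsFiniteMeasure (bdry (T.elem k)) :=
  ⟨by rw [bdry, Measure.restrict_apply_univ]; exact T.bdry_finite k⟩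

lemma ae_mem_frontier (U : Set (Space d)) : ∀ᵐ y ∂(bdry U), y ∈ frontier U :=
  ae_restrict_mem isClosed_frontier.measurableSet

lemma jump_sub_add_jump_ae {u w : Space d → ℝ} {G : Space d → Space d}
    (hu : IsPeriodicGrad u G) (he : ∀ k' ∈ T.patch k, HasTrace (T.elem k') (u - w))
    (hw : ∀ k' ∈ T.patch k, HasTrace (T.elem k') w) :
    ∀ᵐ y ∂(bdry (T.elem k)), jump T (u - w) k y + jump T w k y = 0 := by
  refine T.ae_bdry_of_forall_isFace fun x k' z n r hz h => ?_
  have hk := T.self_mem_patch k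
  have hk' := T.mem_patch_of_mem_neighbors (h.mem_neighbors T hz)
  filter_upwards [h.trace_add_ae_eq (T.isOpen k) (T.isOpen k') (T.subset_cube k)
    (T.subset_cube k') hz hu (he k hk) (hw k hk) (he k' hk') (hw k' hk'),
    ae_mem_frontier (T.elem k)] with y hy hyU hyb
  have e := hy hyb
  rw [jump, jump, h.finsum_across hz hyb hyU, h.finsum_across hz hyb hyU,
    (h.hasNormal (T.isOpen k) hyb hyU).normal_eq,
    (h.hasNormal' (T.isOpen k) (T.isOpen k') hyb hyU).normal_eq]
  simp only [Pi.add_apply] at e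
  calc _ = (trace (T.elem k) (u - w) y + trace (T.elem k) w y) • n -
        (trace (T.elem k') (u - w) (y + z) + trace (T.elem k') w (y + z)) • n := by module
    _ = 0 := by rw [e, sub_self]

lemma gradJump_sub_add_gradJump_ae {V : Space d → ℝ} (hV : IsPotential V) {lam : ℝ}
    {u w : Space d → ℝ} {G : Space d → Space d} (hu : IsPeriodicGrad u G)
    (heq : ∀ χ, IsTest univ χ →
      (∫ x, inner ℝ (G x) (gradient χ x)) + ∫ x, V x * u x * χ x = lam * ∫ x, u x * χ x)
    (he : ∀ k' ∈ T.patch k, HasNormalDeriv (T.elem k') (u - w))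
    (hw : ∀ k' ∈ T.patch k, HasNormalDeriv (T.elem k') w) :
    ∀ᵐ y ∂(bdry (T.elem k)), gradJump T (u - w) k y + gradJump T w k y = 0 := by
  refine T.ae_bdry_of_forall_isFace fun x k' z n r hz h => ?_
  have hk := T.self_mem_patch k
  have hk' := T.mem_patch_of_mem_neighbors (h.mem_neighbors T hz)
  filter_upwards [h.normalDeriv_add_ae_eq (T.isOpen k) (T.isOpen k') (T.subset_cube k)
    (T.subset_cube k') hz hV hu heq (he k hk) (hw k hk) (he k' hk') (hw k' hk'),
    ae_mem_frontier (T.elem k)] with y hy hyU hyb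
  have e := hy hyb
  rw [gradJump, gradJump, h.finsum_across hz hyb hyU, h.finsum_across hz hyb hyU]
  simp only [Pi.add_apply] at e
  linarith

lemma eLpNorm_le_of_add_ae_eq_zero {E α : Type*} [NormedAddCommGroup E] [MeasurableSpace α]
    {μ : Measure α} {f g : α → E} (h : ∀ᵐ y ∂μ, f y + g y = 0) (p : ℝ≥0∞) :
    eLpNorm g p μ ≤ eLpNorm f p μ :=
  (eLpNorm_congr_norm_ae (h.mono fun y hy => by
    rw [eq_neg_of_add_eq_zero_right hy, norm_neg])).le

/-- The jump of `u` vanishes, so the jumps of `w` and of `u - w` are opposite. If `u - w` lacks a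
trace on some element of the patch, the right side is `∞` by convention. -/
lemma jumpNorm_le_jumpNorm_sub {u w : Space d → ℝ} {G : Space d → Space d}
    (hu : IsPeriodicGrad u G) (hw : ∀ k', HasTrace (T.elem k') w) :
    jumpNorm T w k ≤ jumpNorm T (u - w) k := by
  by_cases he : ∀ k' ∈ T.patch k, HasTrace (T.elem k') (u - w)
  · rw [jumpNorm, jumpNorm, if_pos he, if_pos fun k' _ => hw k']
    exact eLpNorm_le_of_add_ae_eq_zero (jump_sub_add_jump_ae hu he fun k' _ => hw k') 2
  · rw [jumpNorm, jumpNorm, if_neg he]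
    exact le_top

lemma gradJumpNorm_le_gradJumpNorm_sub {V : Space d → ℝ} (hV : IsPotential V) {lam : ℝ}
    {u w : Space d → ℝ} {G : Space d → Space d} (hu : IsPeriodicGrad u G)
    (heq : ∀ χ, IsTest univ χ →
      (∫ x, inner ℝ (G x) (gradient χ x)) + ∫ x, V x * u x * χ x = lam * ∫ x, u x * χ x)
    (hw : ∀ k', HasNormalDeriv (T.elem k') w) :
    gradJumpNorm T w k ≤ gradJumpNorm T (u - w) k := by
  by_cases he : ∀ k' ∈ T.patch k, HasNormalDeriv (T.elem k') (u - w)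
  · rw [gradJumpNorm, gradJumpNorm, if_pos he, if_pos fun k' _ => hw k']
    exact eLpNorm_le_of_add_ae_eq_zero
      (gradJump_sub_add_gradJump_ae hV hu heq he fun k' _ => hw k') 2
  · rw [gradJumpNorm, gradJumpNorm, if_neg he]
    exact le_top

/-! ### Summation over the faces of an element -/

lemma PeriodicMesh.symm_mem_across {x : Space d} {p : ι × Space d} (hp : p ∈ T.across k x) :
    (k, x) ∈ T.across p.1 p.2 := by
  obtain ⟨hz, n, h1, h2⟩ := hp
  refine ⟨?_, -n, h2, by simpa using h1⟩
  simpa using neg_mem_lattice hz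

/-- Facing a given element with a given period is a relatively open condition on the frontier: it
persists for all frontier points of the ball that witnesses it. -/
lemma PeriodicMesh.measurableSet_face (T : PeriodicMesh d ι) (k k' : ι) (z : Space d)
    (hz : z ∈ lattice d) : MeasurableSet {y | (k', y + z) ∈ T.across k y} := by
  have e : {y | (k', y + z) ∈ T.across k y} =
      {y | ∃ x n r, IsFace (T.elem k) (T.elem k') x z n r ∧ y ∈ Metric.ball x r} ∩
        frontier (T.elem k) := by
    ext y
    constructor
    · intro hy
      obtain ⟨n, r, h⟩ := T.exists_isFace hy
      simp only [add_sub_cancel_left] at h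
      exact ⟨⟨y, n, r, h, Metric.mem_ball_self h.pos⟩, h.self_mem_frontier T⟩
    · rintro ⟨⟨x, n, r, h, hy⟩, hyU⟩
      exact h.mem_across hz hy hyU
  rw [e]
  refine IsOpen.measurableSet ?_ |>.inter isClosed_frontier.measurableSet
  refine isOpen_iff_mem_nhds.2 fun y ⟨x, n, r, h, hy⟩ => ?_
  exact mem_of_superset (Metric.isOpen_ball.mem_nhds hy) fun w hw => ⟨x, n, r, h, hw⟩

-- The boundary of `k` is covered, up to a null set, by countably many pieces indexed by neighbour
-- and period. Each piece is moved isometrically into the neighbour's boundary, and for a fixed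
-- neighbour the images do not overlap, so every neighbour's boundary integral is used at most once.
open Classical in
lemma PeriodicMesh.lintegral_across_le (T : PeriodicMesh d ι) (k : ι)
    (f : ι → Space d → ℝ≥0∞) :
    ∫⁻ y, ∑ᶠ p ∈ T.across k y, f p.1 p.2 ∂(bdry (T.elem k)) ≤
      ∑ k' ∈ T.neighbors k, ∫⁻ y, f k' y ∂(bdry (T.elem k')) := by
  have := (countable_lattice (d := d)).to_subtype
  let F : ι × lattice d → Set (Space d) := fun q => {y | (q.1, y + q.2.1) ∈ T.across k y}
  have hFm : ∀ q, MeasurableSet (F q) := fun q => T.measurableSet_face k q.1 q.2.1 q.2.2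
  have hFfr : ∀ q, F q ⊆ frontier (T.elem k) := fun q y hy => by
    obtain ⟨n, r, h⟩ := T.exists_isFace hy
    exact h.self_mem_frontier T
  have hFfr' : ∀ q, ∀ y ∈ F q, y + q.2.1 ∈ frontier (T.elem q.1) := fun q y hy => by
    obtain ⟨n, r, h⟩ := T.exists_isFace (PeriodicMesh.symm_mem_across hy)
    exact h.self_mem_frontier T
  have hcov : ∀ᵐ y ∂(bdry (T.elem k)), y ∈ ⋃ q, F q := by
    filter_upwards [T.exists_across k] with y ⟨p, hp⟩
    refine mem_iUnion.2 ⟨(p.1, ⟨p.2 - y, hp.1⟩), ?_⟩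
    simpa [F, PeriodicMesh.across] using hp
  rw [← Measure.restrict_eq_self_of_ae_mem hcov]
  refine (lintegral_iUnion_le _ _).trans ?_
  let F' : ι × lattice d → Set (Space d) := fun q => (fun y => y + -q.2.1) ⁻¹' F q
  have hF'm : ∀ q, MeasurableSet (F' q) := fun q => measurable_add_const _ (hFm q)
  have hF'fr : ∀ q, F' q ⊆ frontier (T.elem q.1) := fun q y hy => by
    simpa using hFfr' q _ hy
  have hshift : ∀ q, ∫⁻ y in F q, (∑ᶠ p ∈ T.across k y, f p.1 p.2) ∂(bdry (T.elem k)) =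
      ∫⁻ y in F' q, f q.1 y ∂(bdry (T.elem q.1)) := fun q => by
    rw [setLIntegral_congr_fun (hFm q) fun y hy => PeriodicMesh.finsum_across_eq (T := T) hy _]
    rw [bdry, bdry, Measure.restrict_restrict (hFm q), Measure.restrict_restrict (hF'm q),
      inter_eq_self_of_subset_left (hFfr q), inter_eq_self_of_subset_left (hF'fr q)]
    have hp := ((IsometryEquiv.addRight q.2.1).measurePreserving_euclideanHausdorffMeasure
      (d - 1)).setLIntegral_comp_preimage_emb
      (MeasurableEquiv.addRight q.2.1).measurableEmbedding (f q.1) (F' q)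
    have hpre : (IsometryEquiv.addRight q.2.1) ⁻¹' F' q = F q := by
      ext y; simp [F']
    rw [hpre] at hp
    exact hp
  -- Read from the neighbour's side: a point of its boundary faces a unique point of `k`, so it
  -- determines the period.
  have hdisj : ∀ k', Pairwise (Function.onFun Disjoint fun z : lattice d => F' (k', z)) := by
    intro k' z z' hzz
    refine disjoint_left.2 fun y hy hy' => hzz ?_
    have h1 := PeriodicMesh.symm_mem_across (T := T) hy
    have h2 := PeriodicMesh.symm_mem_across (T := T) hy'
    simp only [neg_add_cancel_right] at h1 h2
    have := congrArg Prod.snd (T.across_unique h1 h2)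
    simp only [add_right_inj, neg_inj] at this
    exact Subtype.ext this
  simp only [hshift]
  rw [ENNReal.tsum_prod', tsum_fintype]
  refine (Finset.sum_le_sum fun k' _ => ?_ : _ ≤ ∑ k', if k' ∈ T.neighbors k then
    ∫⁻ y, f k' y ∂(bdry (T.elem k')) else 0).trans_eq ?_
  · split_ifs with hk'
    · exact (lintegral_iUnion (fun z => hF'm (k', z)) (hdisj k') (f k')).symm.trans_le
        (setLIntegral_le_lintegral _ _)
    · have : ∀ z : lattice d, F' (k', z) = ∅ := fun z => by
        refine eq_empty_of_forall_notMem fun y hy => hk' ?_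
        exact T.mem_neighbors hy
      simp [this]
  · simp

lemma eLpNorm_two_sq {E α : Type*} [NormedAddCommGroup E] [MeasurableSpace α]
    (μ : Measure α) (f : α → E) : eLpNorm f 2 μ ^ 2 = ∫⁻ y, ‖f y‖ₑ ^ 2 ∂μ := by
  have := eLpNorm_nnreal_pow_eq_lintegral (μ := μ) (f := f) (p := 2) (by norm_num)
  simpa using this

open Classical in
-- Pointwise `(a + b)² ≤ 2(a² + b²)` separates the two sides of each face; the outer contributions
-- are then collected neighbour by neighbour.
lemma gradJumpNorm_sq_le (T : PeriodicMesh d ι) (k : ι) {v : Space d → ℝ}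
    (hv : ∀ k' ∈ T.patch k, HasNormalDeriv (T.elem k') v) :
    gradJumpNorm T v k ^ 2 ≤ 2 * ∑ k' ∈ T.patch k, normalDerivNorm (T.elem k') v ^ 2 := by
  -- No element faces itself, so the patch sum splits into the term of `k` and the terms of its
  -- neighbours without double counting.
  have hnb : k ∉ T.neighbors k := by
    simp only [PeriodicMesh.neighbors, Finset.mem_filter, Finset.mem_univ, true_and]
    rintro ⟨x, p, hp, hpk⟩
    exact T.across_ne k x p hp hpk
  have hN : ∀ k' ∈ T.patch k, normalDerivNorm (T.elem k') v ^ 2 =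
      ∫⁻ y, ‖normalDeriv (T.elem k') v y‖ₑ ^ 2 ∂(bdry (T.elem k')) := fun k' hk' => by
    rw [normalDerivNorm, if_pos (hv k' hk'), eLpNorm_two_sq]
  rw [Finset.sum_congr rfl hN, PeriodicMesh.patch, Finset.sum_insert hnb, gradJumpNorm, if_pos hv,
    eLpNorm_two_sq]
  have hm : AEMeasurable (fun y => ‖normalDeriv (T.elem k) v y‖ₑ ^ 2) (bdry (T.elem k)) :=
    (hv k (T.self_mem_patch k)).isNormalDeriv.2.1.1.enorm.pow_const 2
  calc _ ≤ ∫⁻ y, 2 * (‖normalDeriv (T.elem k) v y‖ₑ ^ 2 +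
        ∑ᶠ p ∈ T.across k y, ‖normalDeriv (T.elem p.1) v p.2‖ₑ ^ 2) ∂(bdry (T.elem k)) := by
        refine lintegral_mono_ae ?_
        filter_upwards [T.exists_across k] with y ⟨p, hp⟩
        rw [gradJump, PeriodicMesh.finsum_across_eq (T := T) hp, PeriodicMesh.finsum_across_eq (T := T) hp]
        have hr : ∀ a b : ℝ, ‖a + b‖ₑ ^ 2 ≤ 2 * (‖a‖ₑ ^ 2 + ‖b‖ₑ ^ 2) := fun a b => by
          simp only [Real.enorm_eq_ofReal_abs, ← ENNReal.ofReal_pow (abs_nonneg _), sq_abs]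
          rw [← ENNReal.ofReal_add (sq_nonneg _) (sq_nonneg _), ← ENNReal.ofReal_ofNat,
            ← ENNReal.ofReal_mul (by norm_num)]
          exact ENNReal.ofReal_le_ofReal (by nlinarith [sq_nonneg (a - b)])
        exact hr _ _
    _ = 2 * (∫⁻ y, ‖normalDeriv (T.elem k) v y‖ₑ ^ 2 ∂(bdry (T.elem k)) +
        ∫⁻ y, (∑ᶠ p ∈ T.across k y, ‖normalDeriv (T.elem p.1) v p.2‖ₑ ^ 2)
          ∂(bdry (T.elem k))) := by
        rw [lintegral_const_mul' _ _ (by simp), lintegral_add_left' hm]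
    _ ≤ _ := by
        gcongr
        exact T.lintegral_across_le k fun k' y => ‖normalDeriv (T.elem k') v y‖ₑ ^ 2

/-! ### The face and jump estimators -/

lemma rpow_half_sq (a : ℝ≥0∞) : (a ^ (1 / 2 : ℝ)) ^ 2 = a := by
  rw [← ENNReal.rpow_natCast, ← ENNReal.rpow_mul]; norm_num

lemma ofReal_sqrt_sq (a : ℝ) : ENNReal.ofReal (Real.sqrt a) ^ 2 = ENNReal.ofReal a := by
  rw [← ENNReal.ofReal_pow (Real.sqrt_nonneg a)]
  rcases le_total 0 a with h | h
  · rw [Real.sq_sqrt h]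
  · simp [Real.sqrt_eq_zero_of_nonpos h, ENNReal.ofReal_of_nonpos h]

lemma le_of_sq_le_sq {a b : ℝ≥0∞} (h : a ^ 2 ≤ b ^ 2) : a ≤ b :=
  (ENNReal.pow_le_pow_left_iff two_ne_zero).1 h

/-- The common factor `X` cancels, and `sqrt(2/γ)` is exactly the inverse of the weight of the jump
in the energy norm. If `X = ∞`, the quotient is `0`. -/
lemma etaJ_div_constCJ_le (W : DGSpace T) {V : Space d → ℝ} {θ : ℝ} {γ : ι → ℝ}
    (hγ : 0 < γ k) {u uN : Space d → ℝ} (h : jumpNorm T uN k ≤ jumpNorm T (u - uN) k) :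
    etaJ W θ γ u uN k / constCJ W θ γ u uN k ≤ energy T V γ (u - uN) k := by
  rw [etaJ, constCJ]
  set X := constB W k * gammaHat T γ k + constC W θ (u - uN) k / 2
  have hq : ENNReal.ofReal (Real.sqrt (2 / γ k)) ≠ 0 := by
    rw [Ne, ENNReal.ofReal_eq_zero, not_le]; positivity
  by_cases hX : X = ⊤
  · rw [hX, ENNReal.mul_top hq, ENNReal.div_top]
    exact zero_le
  · refine ENNReal.div_le_of_le_mul ?_
    rw [mul_comm X, ← mul_assoc]
    gcongr
    refine le_of_sq_le_sq ?_
    rw [mul_pow, ofReal_sqrt_sq, energy, rpow_half_sq]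
    calc jumpNorm T uN k ^ 2 ≤ jumpNorm T (u - uN) k ^ 2 := by gcongr
      _ = (ENNReal.ofReal (γ k / 2) * jumpNorm T (u - uN) k ^ 2) * ENNReal.ofReal (2 / γ k) := by
          rw [mul_right_comm, ← ENNReal.ofReal_mul (by positivity),
            show γ k / 2 * (2 / γ k) = 1 by field_simp, ENNReal.ofReal_one, one_mul]
      _ ≤ _ := by
          gcongr
          exact le_add_right le_add_self

/-- With `M` the maximum of `d^u` and `S` the sum of `‖∇e‖²` over the `c` elements of the patch,
half the gradient jump is at most `sqrt(S/2) M = sqrt(S/c) sqrt(c/2) M`; the factor `1/c` is the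
averaging in the patch norm. -/
lemma etaF_div_constCF_le (W : DGSpace T) {γ : ι → ℝ} {u uN : Space d → ℝ}
    (h1 : ∀ k', MemH1 (T.elem k') (u - uN))
    (h : gradJumpNorm T uN k ≤ gradJumpNorm T (u - uN) k) :
    etaF W uN k / constCF W u uN k ≤ patchEnergy T γ (u - uN) k := by
  rw [etaF, constCF]
  set M := ⨆ k' ∈ T.patch k, constDu T (u - uN) k' with hM
  set c := (T.patch k).card
  have hc : 0 < c := Finset.card_pos.2 ⟨k, T.self_mem_patch k⟩
  have hs : ENNReal.ofReal (Real.sqrt (c / 2)) ≠ 0 := by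
    rw [Ne, ENNReal.ofReal_eq_zero, not_le]; positivity
  by_cases hMtop : M = ⊤
  · by_cases hb : constB W k = 0
    · simp [hb]
    · rw [hMtop, ENNReal.mul_top (mul_ne_zero hb hs), ENNReal.div_top]
      exact zero_le
  have hgtop : ∀ k', gradNorm (T.elem k') (u - uN) ≠ ⊤ := fun k' => by
    rw [gradNorm, if_pos (h1 k')]
    exact (h1 k').isWeakGrad.2.1.2.ne
  -- Valid also where the gradient norm is `0`: finiteness of `M` then forces the normal derivative
  -- to vanish, since a nonzero value over `0` is `∞`.
  have hND : ∀ k' ∈ T.patch k, normalDerivNorm (T.elem k') (u - uN) ≤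
      M * gradNorm (T.elem k') (u - uN) := fun k' hk' =>
    (ENNReal.div_le_iff_le_mul (Or.inr hMtop) (Or.inl (hgtop k'))).1
      (le_iSup₂_of_le (f := fun k' _ => constDu T (u - uN) k') k' hk' le_rfl)
  -- A missing normal derivative would have norm `∞`, against the finite bound just obtained.
  have hreg : ∀ k' ∈ T.patch k, HasNormalDeriv (T.elem k') (u - uN) := fun k' hk' => by
    by_contra hc
    have := hND k' hk'
    rw [normalDerivNorm, if_neg hc, top_le_iff] at this
    exact ENNReal.mul_ne_top hMtop (hgtop k') this
  refine ENNReal.div_le_of_le_mul ?_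
  set S := ∑ k' ∈ T.patch k, gradNorm (T.elem k') (u - uN) ^ 2 with hS
  have hJ : gradJumpNorm T uN k ^ 2 ≤ 2 * (M ^ 2 * S) := by
    calc _ ≤ gradJumpNorm T (u - uN) k ^ 2 := by gcongr
      _ ≤ _ := gradJumpNorm_sq_le T k hreg
      _ ≤ 2 * ∑ k' ∈ T.patch k, (M * gradNorm (T.elem k') (u - uN)) ^ 2 := by
          gcongr with k' hk'
          exact hND k' hk'
      _ = _ := by simp only [mul_pow, ← Finset.mul_sum, hS]
  have key : gradJumpNorm T uN k / 2 ≤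
      patchEnergy T γ (u - uN) k * (ENNReal.ofReal (Real.sqrt (c / 2)) * M) := by
    refine le_of_sq_le_sq ?_
    rw [mul_pow, mul_pow, ofReal_sqrt_sq, patchEnergy, rpow_half_sq, ENNReal.div_eq_inv_mul, mul_pow]
    have hcc : ((c : ℝ≥0∞))⁻¹ * ENNReal.ofReal (c / 2) = 2⁻¹ := by
      rw [ENNReal.ofReal_div_of_pos (by norm_num), ENNReal.ofReal_natCast, ENNReal.ofReal_ofNat,
        div_eq_mul_inv, ← mul_assoc, ENNReal.inv_mul_cancel (by exact_mod_cast hc.ne') (by simp),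
        one_mul]
    calc (2⁻¹ : ℝ≥0∞) ^ 2 * gradJumpNorm T uN k ^ 2 ≤ 2⁻¹ ^ 2 * (2 * (M ^ 2 * S)) := by gcongr
      _ = 2⁻¹ * (M ^ 2 * S) := by
          rw [sq, mul_assoc, ← mul_assoc 2⁻¹ 2, ENNReal.inv_mul_cancel (by simp) (by simp), one_mul]
      _ = S / c * (ENNReal.ofReal (c / 2) * M ^ 2) := by
          rw [← hcc, div_eq_mul_inv S]
          generalize (c : ℝ≥0∞)⁻¹ = i
          ring
      _ ≤ _ := by
          gcongr
          exact le_self_add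
  calc constB W k / 2 * gradJumpNorm T uN k = constB W k * (gradJumpNorm T uN k / 2) := by
        rw [div_eq_mul_inv, div_eq_mul_inv, mul_right_comm, mul_assoc]
    _ ≤ constB W k * (patchEnergy T γ (u - uN) k * (ENNReal.ofReal (Real.sqrt (c / 2)) * M)) := by
        gcongr
    _ = _ := by ring

end Jumps

/-! ### Integration by parts on one element and the residual estimator. -/

section Residual

variable {d : ℕ} {U : Set (Space d)}

/-! ### The scalar product of `L²` -/

section L2

variable {α E : Type*} [MeasurableSpace α] {μ : Measure α} [NormedAddCommGroup E]
  [InnerProductSpace ℝ E] {F G : α → E}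

lemma inner_toLp (hF : MemLp F 2 μ) (hG : MemLp G 2 μ) :
    inner ℝ (hF.toLp F) (hG.toLp G) = ∫ x, inner ℝ (F x) (G x) ∂μ := by
  rw [L2.inner_def]
  refine integral_congr_ae ?_
  filter_upwards [hF.coeFn_toLp, hG.coeFn_toLp] with x h1 h2
  rw [h1, h2]

lemma integral_inner_le (hF : MemLp F 2 μ) (hG : MemLp G 2 μ) :
    ∫ x, inner ℝ (F x) (G x) ∂μ ≤ (eLpNorm F 2 μ).toReal * (eLpNorm G 2 μ).toReal := by
  rw [← inner_toLp hF hG, ← Lp.norm_toLp F hF, ← Lp.norm_toLp G hG]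
  exact real_inner_le_norm _ _

lemma integral_inner_self (hF : MemLp F 2 μ) :
    ∫ x, inner ℝ (F x) (F x) ∂μ = (eLpNorm F 2 μ).toReal ^ 2 := by
  rw [← inner_toLp hF hF, ← Lp.norm_toLp F hF, real_inner_self_eq_norm_sq]

lemma tendsto_integral_inner (hF : MemLp F 2 μ) (hG : MemLp G 2 μ) {H : ℕ → α → E}
    (hH : ∀ n, MemLp (H n) 2 μ) (hlim : Tendsto (fun n => eLpNorm (G - H n) 2 μ) atTop (𝓝 0)) :
    Tendsto (fun n => ∫ x, inner ℝ (F x) (H n x) ∂μ) atTop (𝓝 (∫ x, inner ℝ (F x) (G x) ∂μ)) := by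
  have h : Tendsto (fun n => (hH n).toLp (H n)) atTop (𝓝 (hG.toLp G)) := by
    rw [Lp.tendsto_Lp_iff_tendsto_eLpNorm'' H hH G hG]
    simpa only [eLpNorm_sub_comm] using hlim
  simp only [← inner_toLp hF (hH _), ← inner_toLp hF hG]
  exact tendsto_const_nhds.inner h

end L2

lemma inner_real_eq_mul (a b : ℝ) : inner ℝ a b = a * b := by
  simp [mul_comm]

/-- A weak equation extends from test functions to `H¹_0(U)`. -/
lemma MemH10.integral_inner_wgrad {w f : Space d → ℝ} {F : Space d → Space d}
    (hw : MemH10 U w) (hF : MemLp F 2 (volume.restrict U)) (hf : MemLp f 2 (volume.restrict U))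
    (h : ∀ χ, IsTest U χ → ∫ x in U, inner ℝ (F x) (gradient χ x) = -∫ x in U, f x * χ x) :
    ∫ x in U, inner ℝ (F x) (wgrad U w x) = -∫ x in U, f x * w x := by
  obtain ⟨hw1, χ, hχ, l1, l2⟩ := hw
  have t1 := tendsto_integral_inner hF hw1.isWeakGrad.2.1 (fun n => (hχ n).memLp_gradient 2) l2
  have t2 := tendsto_integral_inner hf hw1.isWeakGrad.1 (fun n => (hχ n).memLp 2) l1
  simp only [inner_real_eq_mul] at t2
  simp only [h _ (hχ _)] at t1
  exact tendsto_nhds_unique t1 t2.neg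

lemma IsPotential.memLp_sqrt_mul {V : Space d → ℝ} (hV : IsPotential V) (hU : IsOpen U)
    (hUc : U ⊆ cube d) {v : Space d → ℝ} (hv : MemLp v 2 (volume.restrict U)) :
    MemLp (fun x => Real.sqrt (V x) * v x) 2 (volume.restrict U) := by
  obtain ⟨C, hC⟩ := hV.bounded
  refine hv.of_le_mul (c := Real.sqrt C) ((Real.continuous_sqrt.comp_aestronglyMeasurable
    (hV.aestronglyMeasurable hU hUc)).mul hv.1) ?_
  filter_upwards [ae_restrict_mem hU.measurableSet] with x hx
  rw [norm_mul, Real.norm_of_nonneg (Real.sqrt_nonneg _)]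
  exact mul_le_mul_of_nonneg_right (Real.sqrt_le_sqrt (hC x (hUc hx))) (norm_nonneg _)

lemma IsBubble.memLp_sqrt_mul {g : Space d → ℝ} (hg : IsBubble U g) (hU : IsOpen U)
    {v : Space d → ℝ} (hv : MemLp v 2 (volume.restrict U)) :
    MemLp (fun x => Real.sqrt (g x) * v x) 2 (volume.restrict U) := by
  refine hv.of_le_mul (c := 1) ((Real.continuous_sqrt.comp
    hg.continuous).aestronglyMeasurable.mul hv.1) ?_
  filter_upwards [ae_restrict_mem hU.measurableSet] with x hx
  rw [norm_mul, Real.norm_of_nonneg (Real.sqrt_nonneg _)]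
  exact mul_le_mul_of_nonneg_right
    (Real.sqrt_le_one.2 (hg.isLUB.1 (mem_image_of_mem g hx))) (norm_nonneg _)

/-! ### The residual estimator -/

/-- `‖∇(w - φ)‖² = ‖∇w‖² + 2 ‖V^{1/2} w‖² + ‖∇φ‖²` if `Δφ = V w`. -/
lemma IsDirichletSolution.norm_sq_wgrad_sub {V : Space d → ℝ} (hV : IsPotential V)
    (hU : IsOpen U) (hUc : U ⊆ cube d) {w φ : Space d → ℝ} (hw : MemH10 U w)
    (hφ : IsDirichletSolution U (fun x => V x * w x) φ) :
    (eLpNorm (wgrad U (w - φ)) 2 (volume.restrict U)).toReal ^ 2 =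
      (eLpNorm (wgrad U w) 2 (volume.restrict U)).toReal ^ 2 +
      2 * (eLpNorm (fun x => Real.sqrt (V x) * w x) 2 (volume.restrict U)).toReal ^ 2 +
      (eLpNorm (wgrad U φ) 2 (volume.restrict U)).toReal ^ 2 := by
  have hwg := hw.1.isWeakGrad
  have hφg := hφ.1.1.isWeakGrad
  -- Since `w` lies in `H¹_0`, it may be used as test function in the equation for `φ`; the cross
  -- term `-2(∇φ, ∇w)` becomes `+2‖V^{1/2} w‖²`.
  have hcross := hw.integral_inner_wgrad hφg.2.1 (hV.memLp_mul hU hUc hwg.1) hφ.2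
  have hVw : ∫ x in U, V x * w x * w x =
      (eLpNorm (fun x => Real.sqrt (V x) * w x) 2 (volume.restrict U)).toReal ^ 2 := by
    rw [← integral_inner_self (hV.memLp_sqrt_mul hU hUc hwg.1)]
    refine setIntegral_congr_fun hU.measurableSet fun x hx => ?_
    simp only [inner_real_eq_mul]
    rw [mul_mul_mul_comm, Real.mul_self_sqrt (hV.pos x (hUc hx)).le, mul_assoc]
  rw [← integral_inner_self (hwg.sub hφg).memH1.isWeakGrad.2.1, ← integral_inner_self hwg.2.1,
    ← integral_inner_self hφg.2.1, ← hVw]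
  have e : ∫ x in U, inner ℝ (wgrad U (w - φ) x) (wgrad U (w - φ) x) =
      ∫ x in U, (inner ℝ (wgrad U w x) (wgrad U w x) - 2 * inner ℝ (wgrad U φ x) (wgrad U w x) +
        inner ℝ (wgrad U φ x) (wgrad U φ x)) := by
    refine integral_congr_ae (((hwg.sub hφg).wgrad_ae hU).mono fun x hx => ?_)
    simp only [hx, Pi.sub_apply, inner_sub_left, inner_sub_right,
      real_inner_comm (wgrad U φ x) (wgrad U w x)]
    ring
  have i1 := integrable_inner_of_memLp hwg.2.1 hwg.2.1
  have i2 := (integrable_inner_of_memLp hφg.2.1 hwg.2.1).const_mul 2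
  have i3 := integrable_inner_of_memLp hφg.2.1 hφg.2.1
  rw [e, integral_add ?_ i3, integral_sub i1 i2, integral_const_mul, hcross]
  · ring
  · exact i1.sub i2

/-- The element residual `R` tested against `w = g R` is controlled by the error `u - v`. -/
lemma residual_bound {V : Space d → ℝ} (hV : IsPotential V) (hU : IsOpen U) (hUc : U ⊆ cube d)
    {lam lamN : ℝ} {u v R w φ : Space d → ℝ} (hu : IsWeakLap U u fun x => V x * u x - lam * u x)
    (hv : ∃ f, IsWeakLap U v f) (hR : R = fun x => lamN * v x + wlap U v x - V x * v x)
    (hw : MemH10 U w) (hφ : IsDirichletSolution U (fun x => V x * w x) φ) :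
    ∫ x in U, R x * w x ≤
      (eLpNorm (fun x => lamN * v x - lam * u x) 2 (volume.restrict U)).toReal *
        (eLpNorm w 2 (volume.restrict U)).toReal +
      Real.sqrt ((eLpNorm (wgrad U (u - v)) 2 (volume.restrict U)).toReal ^ 2 +
        (eLpNorm (fun x => Real.sqrt (V x) * (u - v) x) 2 (volume.restrict U)).toReal ^ 2) *
        (eLpNorm (wgrad U (w - φ)) 2 (volume.restrict U)).toReal := by
  have hvL := isWeakLap_wlap hv
  have huL := hu.1.isWeakGrad.1
  have hvL2 := hvL.1.isWeakGrad.1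
  have hwg := hw.1.isWeakGrad
  have heL := hu.sub hU hvL
  have heg := heL.1.isWeakGrad
  have h1 : MemLp (fun x => lamN * v x - lam * u x) 2 (volume.restrict U) :=
    (hvL2.const_mul lamN).sub (huL.const_mul lam)
  have hVe := hV.memLp_sqrt_mul hU hUc heg.1
  have hVw := hV.memLp_sqrt_mul hU hUc hwg.1
  have e1 := hw.integral_inner_wgrad heg.2.1 heL.2.1 heL.2.2
  have i1 := integrable_inner_of_memLp h1 hwg.1
  have i2 := integrable_mul_of_memLp heL.2.1 hwg.1
  have i3 := integrable_inner_of_memLp hVe hVw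
  -- Pointwise, `R = (lamN v - lam u) - Δ(u - v) + V (u - v)`, because `Δu = V u - lam u`; the
  -- potential is split as `V^{1/2} V^{1/2}` to prepare for Cauchy-Schwarz.
  have e2 : ∫ x in U, R x * w x =
      ∫ x in U, (inner ℝ (lamN * v x - lam * u x) (w x) -
        ((fun x => V x * u x - lam * u x) - wlap U v) x * w x +
        inner ℝ (Real.sqrt (V x) * (u - v) x) (Real.sqrt (V x) * w x)) := by
    refine setIntegral_congr_fun hU.measurableSet fun x hx => ?_
    simp only [hR, inner_real_eq_mul, Pi.sub_apply]
    rw [mul_mul_mul_comm, Real.mul_self_sqrt (hV.pos x (hUc hx)).le]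
    ring
  have i12 : Integrable (fun x => inner ℝ (lamN * v x - lam * u x) (w x) -
      ((fun x => V x * u x - lam * u x) - wlap U v) x * w x) (volume.restrict U) := i1.sub i2
  rw [integral_add i12 i3, integral_sub i1 i2, sub_eq_add_neg, ← e1] at e2
  have c1 := integral_inner_le h1 hwg.1
  have c2 := integral_inner_le heg.2.1 hwg.2.1
  have c3 := integral_inner_le hVe hVw
  have hG := hφ.norm_sq_wgrad_sub hV hU hUc hw
  set A := (eLpNorm (wgrad U (u - v)) 2 (volume.restrict U)).toReal
  set B := (eLpNorm (fun x => Real.sqrt (V x) * (u - v) x) 2 (volume.restrict U)).toReal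
  set A' := (eLpNorm (wgrad U w) 2 (volume.restrict U)).toReal
  set B' := (eLpNorm (fun x => Real.sqrt (V x) * w x) 2 (volume.restrict U)).toReal
  set G := (eLpNorm (wgrad U (w - φ)) 2 (volume.restrict U)).toReal with hGdef
  have hG0 : 0 ≤ G := ENNReal.toReal_nonneg
  -- Cauchy-Schwarz in the plane, with `G² = A'² + 2B'² + ‖∇φ‖²` dominating `A'² + B'²`; the first
  -- hint is Lagrange's square, the others are the surplus terms.
  have hCS : A * A' + B * B' ≤ Real.sqrt (A ^ 2 + B ^ 2) * G := by
    rw [← Real.sqrt_sq hG0, ← Real.sqrt_mul (by positivity), hG]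
    refine Real.le_sqrt_of_sq_le ?_
    nlinarith [sq_nonneg (A * B' - B * A'), mul_nonneg (sq_nonneg A) (sq_nonneg B'),
      mul_nonneg (sq_nonneg B) (sq_nonneg B'), mul_nonneg (add_nonneg (sq_nonneg A) (sq_nonneg B))
        (sq_nonneg (eLpNorm (wgrad U φ) 2 (volume.restrict U)).toReal)]
  linarith

/-- If `‖∇(w - φ)‖` vanishes, so does `‖V^{1/2} w‖`, by the identity for its square, and `V` is
positive. This rules out a zero denominator in the residual estimate. -/
lemma IsDirichletSolution.ae_eq_zero {V : Space d → ℝ} (hV : IsPotential V) (hU : IsOpen U)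
    (hUc : U ⊆ cube d) {w φ : Space d → ℝ} (hw : MemH10 U w)
    (hφ : IsDirichletSolution U (fun x => V x * w x) φ)
    (h : eLpNorm (wgrad U (w - φ)) 2 (volume.restrict U) = 0) : w =ᵐ[volume.restrict U] 0 := by
  have hG := hφ.norm_sq_wgrad_sub hV hU hUc hw
  rw [h, ENNReal.toReal_zero] at hG
  have hVw := hV.memLp_sqrt_mul hU hUc hw.1.isWeakGrad.1
  have h0 : (eLpNorm (fun x => Real.sqrt (V x) * w x) 2 (volume.restrict U)).toReal = 0 := by
    refine pow_eq_zero_iff two_ne_zero |>.1 ?_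
    nlinarith [sq_nonneg (eLpNorm (wgrad U w) 2 (volume.restrict U)).toReal,
      sq_nonneg (eLpNorm (wgrad U φ) 2 (volume.restrict U)).toReal,
      sq_nonneg (eLpNorm (fun x => Real.sqrt (V x) * w x) 2 (volume.restrict U)).toReal]
  rw [ENNReal.toReal_eq_zero_iff, or_iff_left hVw.2.ne, eLpNorm_eq_zero_iff hVw.1 two_ne_zero] at h0
  filter_upwards [h0, ae_restrict_mem hU.measurableSet] with x hx hxU
  exact (mul_eq_zero.1 hx).resolve_left (Real.sqrt_pos.2 (hV.pos x (hUc hxU))).ne'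

variable {ι : Type*} [Fintype ι] {T : PeriodicMesh d ι} {k : ι}

/-- After cancelling `a` and `‖R‖`, the ratio is `‖g^{1/2} R‖² / ‖∇(gR - φ)‖`, and the numerator is
`∫ R (gR)`, to which `residual_bound` applies. Dividing by the gradient norm produces the energy
norm and the higher order term. -/
lemma etaR_div_constCR_le (W : DGSpace T) {V : Space d → ℝ} (hV : IsPotential V) {γ : ι → ℝ}
    {lam lamN : ℝ} {u uN g φ R : Space d → ℝ}
    (hu : IsWeakLap (T.elem k) u fun x => V x * u x - lam * u x)
    (huN : ∃ f, IsWeakLap (T.elem k) uN f) (hR : R = residual T V lamN uN k)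
    (hg : IsBubble (T.elem k) g) (hgR : MemH10 (T.elem k) fun x => g x * R x)
    (hgR0 : l2Norm (T.elem k) R ≠ 0 → l2Norm (T.elem k) (fun x => Real.sqrt (g x) * R x) ≠ 0)
    (hφ : IsDirichletSolution (T.elem k) (fun x => V x * (g x * R x)) φ) :
    etaR W V lamN uN k / constCR W g R φ k ≤
      energy T V γ (u - uN) k + hotLB T lam lamN u uN g R φ k := by
  set U := T.elem k with hUdef
  have hU : IsOpen U := T.isOpen k
  have hUc : U ⊆ cube d := T.subset_cube k
  have huNL := isWeakLap_wlap huN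
  have huNg := huNL.1.isWeakGrad
  have heg := (hu.1.isWeakGrad.sub huNg)
  have hRL : MemLp R 2 (volume.restrict U) := by
    rw [hR]
    exact ((huNg.1.const_mul lamN).add huNL.2.1).sub (hV.memLp_mul hU hUc huNg.1)
  set w : Space d → ℝ := fun x => g x * R x with hw
  have hwL := hgR.1.isWeakGrad.1
  have hSL := hg.memLp_sqrt_mul hU hRL
  have hmL : MemLp (fun x => lamN * uN x - lam * u x) 2 (volume.restrict U) :=
    (huNg.1.const_mul lamN).sub (hu.1.isWeakGrad.1.const_mul lam)
  have hDL := (hgR.1.isWeakGrad.sub hφ.1.1.isWeakGrad)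
  have hb := residual_bound hV hU hUc hu huN hR hgR hφ
  have hSsq : ∫ x in U, R x * w x =
      (eLpNorm (fun x => Real.sqrt (g x) * R x) 2 (volume.restrict U)).toReal ^ 2 := by
    rw [← integral_inner_self hSL]
    refine integral_congr_ae (ae_of_all _ fun x => ?_)
    simp only [inner_real_eq_mul, hw]
    rw [mul_mul_mul_comm, Real.mul_self_sqrt (hg.nonneg x)]
    ring
  have hGdef : gradNorm U (fun x => g x * R x - φ x) =
      eLpNorm (wgrad U (w - φ)) 2 (volume.restrict U) := by
    rw [gradNorm]; exact if_pos hDL.memH1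
  have hGz := hφ.ae_eq_zero hV hU hUc hgR
  rw [etaR, constCR, hotLB, ← hR, ← hUdef, hGdef]
  set S := l2Norm U (fun x => Real.sqrt (g x) * R x) with hS
  set G := eLpNorm (wgrad U (w - φ)) 2 (volume.restrict U) with hG
  set r := l2Norm U R with hr
  have hGtop : G ≠ ⊤ := hDL.memH1.isWeakGrad.2.1.2.ne
  have hStop : S ≠ ⊤ := hSL.2.ne
  by_cases hr0 : r = 0
  · simp [hr0]
  have hS0 : S ≠ 0 := hgR0 hr0
  have hG0 : G ≠ 0 := by
    intro h
    refine hS0 ((eLpNorm_eq_zero_iff hSL.1 two_ne_zero).2 ((hGz h).mono fun x hx => ?_))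
    rcases mul_eq_zero.1 hx with h | h <;> simp [h]
  -- An infinite `a` makes the denominator infinite, since the other factor is nonzero; the quotient
  -- is then `0`.
  by_cases ha : constA W k = ⊤
  · rw [ha, ENNReal.top_mul (ENNReal.div_ne_zero.2
      ⟨mul_ne_zero hr0 hG0, ENNReal.pow_ne_top hStop⟩), ENNReal.div_top]
    exact zero_le
  refine ENNReal.div_le_of_le_mul ?_
  -- The jump part of the energy norm is discarded here.
  have hEb : ENNReal.ofReal (Real.sqrt ((eLpNorm (wgrad U (u - uN)) 2
      (volume.restrict U)).toReal ^ 2 + (eLpNorm (fun x => Real.sqrt (V x) * (u - uN) x) 2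
      (volume.restrict U)).toReal ^ 2)) ≤ energy T V γ (u - uN) k := by
    refine le_of_sq_le_sq ?_
    rw [ofReal_sqrt_sq, energy, rpow_half_sq, ENNReal.ofReal_add (by positivity) (by positivity),
      ENNReal.ofReal_pow ENNReal.toReal_nonneg, ENNReal.ofReal_pow ENNReal.toReal_nonneg,
      ENNReal.ofReal_toReal heg.memH1.isWeakGrad.2.1.2.ne,
      ENNReal.ofReal_toReal (hV.memLp_sqrt_mul hU hUc heg.1).2.ne, gradNorm, if_pos heg.memH1]
    exact add_le_add le_self_add le_rfl
  have hkey : S ^ 2 ≤ (energy T V γ (u - uN) k +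
      l2Norm U (fun x => lamN * uN x - lam * u x) * (l2Norm U w / G)) * G := by
    rw [hSsq] at hb
    have hb' := ENNReal.ofReal_le_ofReal hb
    rw [ENNReal.ofReal_pow ENNReal.toReal_nonneg, ENNReal.ofReal_toReal hSL.2.ne,
      ENNReal.ofReal_add (by positivity) (by positivity), ENNReal.ofReal_mul (by positivity),
      ENNReal.ofReal_mul (by positivity), ENNReal.ofReal_toReal hGtop,
      ENNReal.ofReal_toReal hwL.2.ne, ENNReal.ofReal_toReal hmL.2.ne] at hb'
    refine hb'.trans ?_
    rw [add_mul, mul_assoc (l2Norm U _), ENNReal.div_mul_cancel hG0 hGtop, add_comm]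
    exact add_le_add (mul_le_mul' hEb le_rfl) le_rfl
  -- Multiplying by `S² / S² = 1` exposes `S²` for the bound `hkey`; the remaining factors are those
  -- of the constant in the denominator.
  calc constA W k * r = constA W k * (r * (S ^ 2 / S ^ 2)) := by
        rw [ENNReal.div_self (pow_ne_zero 2 hS0) (ENNReal.pow_ne_top hStop), mul_one]
    _ ≤ constA W k * (r * (((energy T V γ (u - uN) k +
        l2Norm U (fun x => lamN * uN x - lam * u x) * (l2Norm U w / G)) * G) / S ^ 2)) := by
        gcongr
    _ = _ := by
        simp only [div_eq_mul_inv]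
        ring

end Residual

/-! ### Regularity of discrete functions and assembly of the three bounds. -/

lemma DGSpace.Mem.hasTrace {d : ℕ} {ι : Type*} [Fintype ι] {T : PeriodicMesh d ι} {W : DGSpace T}
    {v : Space d → ℝ} (hv : W.Mem v) (k : ι) : HasTrace (T.elem k) v := by
  obtain ⟨w, hw, hvw⟩ := hv k
  exact (W.regular k w hw).1.congr (T.isOpen k) hvw.symm

lemma DGSpace.Mem.hasNormalDeriv {d : ℕ} {ι : Type*} [Fintype ι] {T : PeriodicMesh d ι}
    {W : DGSpace T} {v : Space d → ℝ} (hv : W.Mem v) (k : ι) : HasNormalDeriv (T.elem k) v := by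
  obtain ⟨w, hw, hvw⟩ := hv k
  exact (W.regular k w hw).2.congr (T.isOpen k) hvw.symm

end DGEigen

theorem mainTheorem2 {d : ℕ} (hd : 1 ≤ d) (hd3 : d ≤ 3) {ι : Type*} [Fintype ι]
    (T : DGEigen.PeriodicMesh d ι) (W : DGEigen.DGSpace T)
    (V : DGEigen.Space d → ℝ) (hV : DGEigen.IsPotential V)
    (θ : ℝ) (γ : ι → ℝ) (hγ : ∀ k, 0 < γ k)
    (lam : ℝ) (u : DGEigen.Space d → ℝ) (hu : DGEigen.IsEigenpair V lam u)
    (hu2 : ∀ k, DGEigen.MemH2 (T.elem k) u)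
    (lamN : ℝ) (uN : DGEigen.Space d → ℝ) (huN : DGEigen.IsDGEigenpair W V θ γ lamN uN)
    (k : ι) (R : DGEigen.Space d → ℝ) (hR : R = DGEigen.residual T V lamN uN k)
    (g : DGEigen.Space d → ℝ) (hg : DGEigen.IsBubble (T.elem k) g)
    (hgR : DGEigen.MemH10 (T.elem k) (fun x => g x * R x))
    (hgR0 : DGEigen.l2Norm (T.elem k) R ≠ 0 →
      DGEigen.l2Norm (T.elem k) (fun x => Real.sqrt (g x) * R x) ≠ 0)
    (φ : DGEigen.Space d → ℝ)
    (hφ : DGEigen.IsDirichletSolution (T.elem k) (fun x => V x * (g x * R x)) φ) :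
    DGEigen.xi W V θ γ lamN u uN g φ k ≤
      max (DGEigen.energy T V γ (u - uN) k + DGEigen.hotLB T lam lamN u uN g R φ k)
        (DGEigen.patchEnergy T γ (u - uN) k) := by
  obtain ⟨-, G, hG, heq⟩ := hu
  have hT := huN.1.hasTrace
  have hN := huN.1.hasNormalDeriv
  rw [DGEigen.xi, ← hR]
  refine max_le ((DGEigen.etaR_div_constCR_le W hV
    (DGEigen.isWeakLap_of_weak_equation (T.isOpen k) (T.subset_cube k) hV hG heq)
    (hN k).isNormalDeriv.1 hR hg hgR hgR0 hφ).trans (le_max_left _ _)) (max_le ?_ ?_)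
  · exact (DGEigen.etaF_div_constCF_le W
      (fun k' => (hG.isWeakGrad (T.subset_cube k')).memH1.sub (hT k').memH1)
      (DGEigen.gradJumpNorm_le_gradJumpNorm_sub hV hG heq hN)).trans (le_max_right _ _)
  · exact (DGEigen.etaJ_div_constCJ_le W (hγ k) (DGEigen.jumpNorm_le_jumpNorm_sub hG hT)).trans
      (le_self_add.trans (le_max_left _ _))
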